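/- Let $n$ be a positive integer and let $A=(a_{ij})$ be a symmetrizable generalized Cartan matrix indexed by $S=\{1,\dots,n\}$. Let $\mathfrak h$ be the Cartan subalgebra of the Kac--Moody algebra $\mathfrak g(A)$, i.e. $(\mathfrak h,\{\alpha_i\},\{\alpha_i^\vee\})$ is a realization of $A$: $\mathfrak h$ is a complex vector space of dimension $2n-\operatorname{rank}A$, the simple roots $\alpha_i\in\mathfrak h^*$ and the simple coroots $\alpha_i^\vee\in\mathfrak h$ are each linearly independent, and $\alpha_j(\alpha_i^\vee)=a_{ij}$. Fix $\rho\in\mathfrak h^*$ with $\rho(\alpha_i^\vee)=1$ for all $i$. For $I\subseteq S$ let $W_I\subseteq GL(\mathfrak h^*)$ be generated by the reflections $s_i(\nu)=\nu-\nu(\alpha_i^\vee)\alpha_i$, $i\in I$, and let $\ell$ be the length with respect to the simple reflections. Call $I$ connected if the submatrix of $A$ indexed by $I$ is indecomposable. Let $\mathcal P$ be the set of pairs $(\lambda,I)$ with $\lambda\in\mathfrak h^*$ and $I\subseteq S$ such that $\lambda(\alpha_i^\vee)$ is a non-negative integer for every $i\in I$, and let $\mathcal C$ be the set of $(\lambda,I)\in\mathcal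 P$ with $I$ connected and nonempty. For $(\lambda,I)\in\mathcal P$ put $$U(\lambda,I)=\sum_{w\in W_I}(-1)^{\ell(w)}e^{w(\lambda+\rho)-(\lambda+\rho)},\qquad L(\lambda,I)=-\log U(\lambda,I),$$ where $U(\lambda,I)$ is viewed as a formal power series in $x_i=e^{-\alpha_i}$ ($i\in S$), whose constant term is $1$, and $\log$ is the formal logarithm. Let $r,s\ge 0$ and let $(\lambda_1,I_1),\dots,(\lambda_r,I_r)$ and $(\mu_1,J_1),\dots,(\mu_s,J_s)$ be elements of $\mathcal C$. Then $$\sum_{k=1}^r L(\lambda_k,I_k)=\sum_{k=1}^s L(\mu_k,J_k)$$ if and only if $r=s$ and there is a permutation $\sigma\in\mathfrak S_r$ such that, for every $1\le k\le r$, $I_k=J_{\sigma(k)}$ and $\lambda_k(\alpha_i^\vee)=\mu_{\sigma(k)}(\alpha_i^\vee)$ for all $i\in I_k$. -/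

import Mathlib

open Module

/-- A generalized Cartan matrix on the index set `S = Fin n`. -/
structure GCM (n : ℕ) where
  entry : Matrix (Fin n) (Fin n) ℤ
  diag : ∀ i, entry i i = 2
  nonpos : ∀ i j, i ≠ j → entry i j ≤ 0
  zero_iff : ∀ i j, entry i j = 0 ↔ entry j i = 0

/-- A square matrix is indecomposable if its index set cannot be split into two nonempty parts
such that all entries linking the two parts vanish. -/
def IndecomposableMatrix {ι : Type*} (B : Matrix ι ι ℤ) : Prop :=
  ∀ s : Set ι, s.Nonempty → sᶜ.Nonempty → ∃ i ∈ s, ∃ j ∈ sᶜ, B i j ≠ 0 ∨ B j i ≠ 0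

namespace GCM

variable {n : ℕ}

/-- `A` is symmetrizable if `D * A` is symmetric for some diagonal matrix `D` with positive real
diagonal entries. -/
def Symmetrizable (A : GCM n) : Prop :=
  ∃ d : Fin n → ℝ, (∀ i, 0 < d i) ∧
    (Matrix.diagonal d * A.entry.map (Int.cast : ℤ → ℝ)).IsSymm

/-- `I ⊆ S` is connected if the submatrix of `A` indexed by `I` is indecomposable. -/
def ConnectedSubset (A : GCM n) (I : Set (Fin n)) : Prop :=
  IndecomposableMatrix (A.entry.submatrix ((↑) : I → Fin n) ((↑) : I → Fin n))

/-- A (minimal) realization of the generalized Cartan matrix `A` over `ℂ`: the vector space `H` is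
the Cartan subalgebra of the Kac-Moody algebra of `A`, with its simple roots in the dual of `H` and
its simple coroots in `H`. -/
structure Realization (A : GCM n) (H : Type*) [AddCommGroup H] [Module ℂ H] where
  finite : Module.Finite ℂ H
  root : Fin n → Dual ℂ H
  coroot : Fin n → H
  root_linearIndependent : LinearIndependent ℂ root
  coroot_linearIndependent : LinearIndependent ℂ coroot
  pairing : ∀ i j, root j (coroot i) = (A.entry i j : ℂ)
  finrank_add_rank :
    Module.finrank ℂ H + (A.entry.map (Int.cast : ℤ → ℂ)).rank = 2 * n

namespace Realization

variable {A : GCM n} {H : Type*} [AddCommGroup H] [Module ℂ H] (R : A.Realization H)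

theorem eval_coroot_root (i : Fin n) : Dual.eval ℂ H (R.coroot i) (R.root i) = 2 := by
  simp [R.pairing, A.diag]

/-- The simple reflection `s_i`, sending `ν` to `ν - ν (α_i^∨) • α_i`. -/
noncomputable def simpleReflection (i : Fin n) : Dual ℂ H ≃ₗ[ℂ] Dual ℂ H :=
  Module.reflection (R.eval_coroot_root i)

theorem simpleReflection_apply (i : Fin n) (ν : Dual ℂ H) :
    R.simpleReflection i ν = ν - ν (R.coroot i) • R.root i := by
  simp [simpleReflection, Module.reflection_apply]

/-- The parabolic subgroup `W_I` of the Weyl group, inside the general linear group of the dual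
of `H`. -/
noncomputable def parabolicWeyl (I : Set (Fin n)) : Subgroup (Dual ℂ H ≃ₗ[ℂ] Dual ℂ H) :=
  Subgroup.closure (R.simpleReflection '' I)

/-- The length `ℓ(w)`: the least number of factors in an expression of `w` as a product of simple
reflections. -/
noncomputable def length (w : Dual ℂ H ≃ₗ[ℂ] Dual ℂ H) : ℕ :=
  sInf {k | ∃ l : List (Fin n), l.length = k ∧ (l.map R.simpleReflection).prod = w}

/-- The integrability `J_lam` of a weight: all `i` with `lam (α_i^∨)` a non-negative integer. -/
def integrability (lam : Dual ℂ H) : Set (Fin n) :=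
  {i | ∃ m : ℕ, lam (R.coroot i) = (m : ℂ)}

/-- The set `𝒫` of pairs `(lam, I)` with `I ⊆ J_lam`. -/
def parabolicPairs : Set (Dual ℂ H × Set (Fin n)) :=
  {p | p.2 ⊆ R.integrability p.1}

/-- The set `𝒞` of pairs in `𝒫` whose second component is nonempty and connected. -/
def connectedPairs : Set (Dual ℂ H × Set (Fin n)) :=
  {p | p ∈ R.parabolicPairs ∧ A.ConnectedSubset p.2 ∧ p.2.Nonempty}

/-- The coefficient of `e^ν` in the formal sum
`U(lam, I) = e^{-lam} ∑_{w ∈ W_I} (-1)^{ℓ(w)} e^{w(lam + ρ) - ρ}`. For a pair in `𝒫` at most one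
`w` contributes to each `ν`. -/
noncomputable def numeratorCoeff (ρ : Dual ℂ H) (p : Dual ℂ H × Set (Fin n)) (ν : Dual ℂ H) : ℚ :=
  ∑ᶠ w ∈ {w | w ∈ R.parabolicWeyl p.2 ∧ w (p.1 + ρ) - (p.1 + ρ) = ν}, (-1 : ℚ) ^ R.length w

/-- `U(lam, I)` as a formal power series in the variables `x_i = e^{-α_i}`: the monomial
`∏ x_i ^ d i` is `e^ν` with `ν = -∑ d i • α_i`. For a pair in `𝒫` all exponents occurring in
`U(lam, I)` are of this form, and the constant term is `1`. -/
noncomputable def normalizedNumerator (ρ : Dual ℂ H) (p : Dual ℂ H × Set (Fin n)) :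
    MvPowerSeries (Fin n) ℚ :=
  fun d => R.numeratorCoeff ρ p (-∑ i, d i • R.root i)

/-- `L(lam, I) = -log U(lam, I)`, the formal logarithm being the substitution of
`U(lam, I) - 1` in the power series `log (1 + X)`. -/
noncomputable def L (ρ : Dual ℂ H) (p : Dual ℂ H × Set (Fin n)) : MvPowerSeries (Fin n) ℚ :=
  -(PowerSeries.log ℚ).subst (R.normalizedNumerator ρ p - 1)

/-- The relation `(lam, I) ≈ (mu, J)`: `I = J`, and `lam`, `mu` agree on the coroots of `I`. -/
def PairEquiv (p q : Dual ℂ H × Set (Fin n)) : Prop :=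
  p.2 = q.2 ∧ ∀ i ∈ p.2, p.1 (R.coroot i) = q.1 (R.coroot i)

end Realization

end GCM

/-! For a pair (λ, I) put `m i` = (λ + ρ)(α_i^∨) for i ∈ I. Monomials of U(λ, I) involve only
variables indexed by I, and every exponent that occurs is at least `m i`. Those whose occurring
exponents all equal `m i` come from products of pairwise commuting simple reflections, so they form
the signed independence polynomial of the Dynkin graph on I in the x_i ^ m_i
(`isIndepLike_normalizedNumerator`).

The support bound passes to L. For connected I the extremal monomial ∏_{i ∈ I} x_i ^ m_i has
positive coefficient in L (`IsIndepLike.coeff_log_pos`): up to the relevant degree, x_v ∂_v(-log U)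
is m_v x_v ^ m_v P(N[v]) / U, where P(N) is the independence polynomial of I \ N, and the deletion
recurrence for P gives positivity, as in the theory of heaps.

The extremal monomial of (μ, J) can thus occur in L(λ, I) only if J ⊆ I and m_λ ≤ m_μ on J. Ordering
classes by decreasing |I| and then by increasing ∑ m makes the system triangular, so multiplicities
can be read off (`multiset_eq_of_sum_map_eq`).

The facts needed about W_I are proved by following Λ = λ + ρ: every w ∈ W_I lowers Λ through
positive steps (`Descent.exists_of_mem`), which is reduced to rank two in `Descent.stable`. -/

/-! ### Formal logarithm and supports of power series. -/

namespace MvPowerSeries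

variable {σ : Type*}

theorem coeff_pow_eq_zero_of_degree_lt {R : Type*} [CommRing R] {f : MvPowerSeries σ R}
    (hf : constantCoeff f = 0) {d : σ →₀ ℕ} {k : ℕ} (h : d.degree < k) :
    coeff d (f ^ k) = 0 :=
  coeff_eq_zero_of_constantCoeff_nilpotent (m := 1) (by simpa using hf) (by omega)

theorem coeff_mul_congr_of_le {R : Type*} [CommRing R] {f g h : MvPowerSeries σ R} {D : σ →₀ ℕ}
    (H : ∀ d ≤ D, coeff d f = coeff d g) : coeff D (f * h) = coeff D (g * h) := by
  classical
  rw [coeff_mul, coeff_mul]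
  refine Finset.sum_congr rfl fun x hx => ?_
  rw [H _ ((Finset.HasAntidiagonal.mem_antidiagonal.1 hx) ▸ le_self_add)]

theorem coeff_log_subst {f : MvPowerSeries σ ℚ} (hf : constantCoeff f = 0) {d : σ →₀ ℕ} {N : ℕ}
    (h : d.degree < N) :
    coeff d ((PowerSeries.log ℚ).subst f) =
      coeff d (∑ k ∈ Finset.range N, PowerSeries.coeff k (PowerSeries.log ℚ) • f ^ k) := by
  rw [PowerSeries.coeff_subst (PowerSeries.HasSubst.of_constantCoeff_zero hf), map_sum]
  simp only [coeff_smul]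
  refine finsum_eq_sum_of_support_subset _ fun k hk => ?_
  by_contra hk'
  simp only [Finset.coe_range, Set.mem_Iio, not_lt] at hk'
  exact hk (by simp [coeff_pow_eq_zero_of_degree_lt hf (h.trans_le hk')])

/-- The derivative of the truncated logarithm is a finite geometric sum in -f, which telescopes
against 1 + f. -/
theorem one_add_mul_pderiv_sum_log (f : MvPowerSeries σ ℚ) (v : σ) (N : ℕ) :
    (1 + f) * pderiv ℚ v
      (∑ k ∈ Finset.range (N + 1), PowerSeries.coeff k (PowerSeries.log ℚ) • f ^ k) =
      (1 - (-f) ^ N) * pderiv ℚ v f := by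
  induction N with
  | zero => simp
  | succ N ih =>
    rw [Finset.sum_range_succ, map_add, mul_add, ih, Derivation.map_smul, pderiv_pow,
      PowerSeries.coeff_log, if_neg (by omega), smul_eq_C_mul]
    have h1 : (C ((-1 : ℚ) ^ (N + 1 + 1) / ((N + 1 : ℕ) : ℚ)) : MvPowerSeries σ ℚ) *
        ((N + 1 : ℕ) : MvPowerSeries σ ℚ) = (-1) ^ N := by
      rw [← map_natCast (C : ℚ →+* MvPowerSeries σ ℚ), ← map_mul,
        div_mul_cancel₀ _ (by positivity)]
      simp [pow_succ]
    have h2 : (-f) ^ N = (-1) ^ N * f ^ N := neg_pow f N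
    simp only [Algebra.algebraMap_self, RingHom.id_apply]
    calc _ = (1 - (-f) ^ N) * pderiv ℚ v f + (1 + f) * ((C ((-1 : ℚ) ^ (N + 1 + 1) /
          ((N + 1 : ℕ) : ℚ)) * ((N + 1 : ℕ) : MvPowerSeries σ ℚ)) * f ^ N * pderiv ℚ v f) := by
          simp [mul_assoc]
      _ = _ := by rw [h1, pow_succ, h2]; ring

/-- The chain rule for the formal logarithm. -/
theorem one_add_mul_pderiv_log_subst {f : MvPowerSeries σ ℚ} (hf : constantCoeff f = 0) (v : σ) :
    (1 + f) * pderiv ℚ v ((PowerSeries.log ℚ).subst f) = pderiv ℚ v f := by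
  ext e
  -- Differentiation reads coefficients one degree higher, so the logarithm must be exact through
  -- degree `N`, while (-f)^N is invisible in degree `e.degree`.
  set N := e.degree + 1 with hN
  have h1 : coeff e ((1 + f) * pderiv ℚ v ((PowerSeries.log ℚ).subst f)) =
      coeff e ((1 - (-f) ^ N) * pderiv ℚ v f) := by
    rw [← one_add_mul_pderiv_sum_log, mul_comm (1 + f), mul_comm (1 + f)]
    refine coeff_mul_congr_of_le fun d hd => ?_
    rw [coeff_pderiv, coeff_pderiv, coeff_log_subst hf (N := N + 1)]
    have := Finsupp.degree_mono hd
    simp only [map_add, Finsupp.degree_single]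
    omega
  have h2 : coeff e ((-f) ^ N * pderiv ℚ v f) = coeff e (0 * pderiv ℚ v f) := by
    refine coeff_mul_congr_of_le fun d hd => ?_
    have := Finsupp.degree_mono hd
    simpa using coeff_pow_eq_zero_of_degree_lt (f := -f) (by simpa using hf) (by omega)
  rw [h1, sub_mul, map_sub, h2]
  simp

/-- Every monomial of `f` involves only variables in `I`, and the exponent of each variable that
occurs in it is at least the value of `m` there. -/
def SupportedAbove (I : Finset σ) (m : σ → ℕ) (f : MvPowerSeries σ ℚ) : Prop :=
  ∀ d, coeff d f ≠ 0 → ∀ i, d i ≠ 0 → i ∈ I ∧ m i ≤ d i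

namespace SupportedAbove

variable {I : Finset σ} {m : σ → ℕ} {f g : MvPowerSeries σ ℚ}

theorem one : SupportedAbove I m 1 := by
  classical
  intro d hd i hi
  rw [coeff_one] at hd
  simp_all

theorem sub (hf : SupportedAbove I m f) (hg : SupportedAbove I m g) :
    SupportedAbove I m (f - g) := by
  intro d hd i hi
  by_cases h : coeff d f = 0
  · refine hg d (fun h' => hd ?_) i hi
    simp [h, h']
  · exact hf d h i hi

theorem mul (hf : SupportedAbove I m f) (hg : SupportedAbove I m g) :
    SupportedAbove I m (f * g) := by
  classical
  intro d hd i hi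
  rw [coeff_mul] at hd
  obtain ⟨x, hx, hx'⟩ := Finset.exists_ne_zero_of_sum_ne_zero hd
  replace hx := Finset.HasAntidiagonal.mem_antidiagonal.1 hx
  have hi' : x.1 i + x.2 i = d i := by rw [← hx]; rfl
  by_cases h : x.1 i = 0
  · have := hg _ (right_ne_zero_of_mul hx') i (by omega)
    exact ⟨this.1, by omega⟩
  · have := hf _ (left_ne_zero_of_mul hx') i h
    exact ⟨this.1, by omega⟩

theorem pow (hf : SupportedAbove I m f) (k : ℕ) : SupportedAbove I m (f ^ k) := by
  induction k with
  | zero => simpa using one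
  | succ k ih => rw [pow_succ]; exact ih.mul hf

theorem log_subst (hf : SupportedAbove I m f) (h0 : constantCoeff f = 0) :
    SupportedAbove I m ((PowerSeries.log ℚ).subst f) := by
  intro d hd
  rw [coeff_log_subst h0 (Nat.lt_succ_self _), map_sum] at hd
  obtain ⟨k, -, hk⟩ := Finset.exists_ne_zero_of_sum_ne_zero hd
  rw [coeff_smul] at hk
  exact hf.pow k d (right_ne_zero_of_mul hk)

end SupportedAbove

/-- The exponent that agrees with `m` on `S` and vanishes elsewhere. -/
noncomputable def restrictExp (m : σ → ℕ) (S : Finset σ) : σ →₀ ℕ :=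
  ∑ i ∈ S, Finsupp.single i (m i)

theorem restrictExp_apply [DecidableEq σ] (m : σ → ℕ) (S : Finset σ) (i : σ) :
    restrictExp m S i = if i ∈ S then m i else 0 := by
  simp [restrictExp, Finsupp.finsetSum_apply, Finsupp.single_apply]

theorem restrictExp_injective {m : σ → ℕ} (hm : ∀ i, 0 < m i) :
    Function.Injective (restrictExp m) := by
  classical
  intro S T h
  ext i
  have := DFunLike.congr_fun h i
  simp only [restrictExp_apply] at this
  have := hm i
  split_ifs at * <;> simp_all

theorem prod_neg_X_pow (m : σ → ℕ) (K : Finset σ) :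
    ∏ i ∈ K, (-(X i : MvPowerSeries σ ℚ) ^ m i) = monomial (restrictExp m K) ((-1) ^ K.card) := by
  classical
  induction K using Finset.induction_on with
  | empty => simp [restrictExp]
  | insert i K hi ih =>
    rw [Finset.prod_insert hi, ih, X_pow_eq, Finset.card_insert_of_notMem hi, restrictExp,
      restrictExp, Finset.sum_insert hi, ← map_neg, monomial_mul_monomial, pow_succ]
    ring_nf

/-- Each nonzero exponent is squeezed between m i and m i. Hence below the extremal monomial only
the monomials indexed by subsets matter. -/
theorem eq_restrictExp_of_le {m : σ → ℕ} {S : Finset σ} {d : σ →₀ ℕ} (hd : d ≤ restrictExp m S)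
    (h : ∀ i, d i ≠ 0 → m i ≤ d i) : d = restrictExp m d.support := by
  classical
  ext i
  have h1 := hd i
  rw [restrictExp_apply] at h1 ⊢
  have h2 := h i
  simp only [Finsupp.mem_support_iff]
  split_ifs at * <;> omega

theorem coeff_X_pow_mul [DecidableEq σ] (g : MvPowerSeries σ ℚ) {m : σ → ℕ} (S : Finset σ) (v : σ) (hm : 0 < m v) :
    coeff (restrictExp m S) (X v ^ m v * g) =
      if v ∈ S then coeff (restrictExp m (S.erase v)) g else 0 := by
  rw [X_pow_eq, coeff_monomial_mul, one_mul]
  by_cases hv : v ∈ S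
  · have : restrictExp m S = Finsupp.single v (m v) + restrictExp m (S.erase v) := by
      rw [restrictExp, restrictExp,
        Finset.add_sum_erase _ (fun i => Finsupp.single i (m i)) hv]
    rw [if_pos hv, this, if_pos le_self_add, add_tsub_cancel_left]
  · rw [if_neg hv, if_neg]
    intro hle
    have := hle v
    simp only [Finsupp.single_eq_same, restrictExp_apply, if_neg hv] at this
    omega

theorem coeff_X_mul_pderiv (f : MvPowerSeries σ ℚ) (v : σ) (d : σ →₀ ℕ) :
    coeff d (X v * pderiv ℚ v f) = d v * coeff d f := by
  rw [X, coeff_monomial_mul, one_mul]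
  split_ifs with hle
  · rw [coeff_pderiv, tsub_add_cancel_of_le hle, mul_comm]
    congr 1
    have := hle v
    simp only [Finsupp.single_eq_same] at this
    simp [Nat.cast_sub this]
  · have : d v = 0 := by
      by_contra h0
      exact hle (by simpa using Nat.one_le_iff_ne_zero.2 h0)
    simp [this]

end MvPowerSeries

/-! ### Independence polynomials and their deletion recurrence. -/

namespace SimpleGraph

open MvPowerSeries

variable {V : Type*} [Fintype V] [DecidableEq V] (G : SimpleGraph V)

open scoped Classical in
/-- The independent sets of `G` contained in `I` and disjoint from `N`. -/
noncomputable def indepAvoiding (I N : Finset V) : Finset (Finset V) :=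
  {K | K ⊆ I ∧ G.IsIndepSet K ∧ Disjoint K N}

theorem mem_indepAvoiding {I N K : Finset V} :
    K ∈ G.indepAvoiding I N ↔ K ⊆ I ∧ G.IsIndepSet K ∧ Disjoint K N := by
  simp [indepAvoiding]

/-- The signed independence polynomial of the subgraph induced on `I \ N`. -/
noncomputable def indepPoly {R : Type*} [CommRing R] (Y : V → R) (I N : Finset V) : R :=
  ∑ K ∈ G.indepAvoiding I N, ∏ i ∈ K, -Y i

open scoped Classical in
/-- The closed neighbourhood of `v`. -/
noncomputable def closedNeighbors (v : V) : Finset V := {j | j = v ∨ G.Adj v j}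

theorem mem_closedNeighbors {v j : V} : j ∈ G.closedNeighbors v ↔ j = v ∨ G.Adj v j := by
  simp [closedNeighbors]

theorem insert_mem_indepAvoiding {I N K : Finset V} {v : V} (hv : v ∈ I) (hvN : v ∉ N)
    (hK : K ∈ G.indepAvoiding I (N ∪ G.closedNeighbors v)) :
    v ∉ K ∧ insert v K ∈ G.indepAvoiding I N := by
  simp only [mem_indepAvoiding, Finset.disjoint_left, Finset.mem_union, mem_closedNeighbors,
    SimpleGraph.IsIndepSet, not_or] at hK ⊢
  obtain ⟨h1, h2, h3⟩ := hK
  refine ⟨fun h => (h3 h).2.1 rfl, Finset.insert_subset hv h1, ?_, ?_⟩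
  · rw [Finset.coe_insert, Set.pairwise_insert]
    exact ⟨h2, fun b hb _ => ⟨(h3 hb).2.2, fun h => (h3 hb).2.2 h.symm⟩⟩
  · intro a ha
    rcases Finset.mem_insert.1 ha with rfl | ha
    exacts [hvN, (h3 ha).1]

theorem erase_mem_indepAvoiding {I N K : Finset V} {v : V} (hvK : v ∈ K)
    (hK : K ∈ G.indepAvoiding I N) :
    K.erase v ∈ G.indepAvoiding I (N ∪ G.closedNeighbors v) := by
  simp only [mem_indepAvoiding, Finset.disjoint_left, Finset.mem_union, mem_closedNeighbors,
    SimpleGraph.IsIndepSet, not_or] at hK ⊢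
  obtain ⟨h1, h2, h3⟩ := hK
  refine ⟨(Finset.erase_subset _ _).trans h1, h2.mono (by simp), fun a ha => ?_⟩
  obtain ⟨h4, h5⟩ := Finset.mem_erase.1 ha
  exact ⟨h3 h5, h4, h2 hvK h5 (Ne.symm h4)⟩

variable {R : Type*} [CommRing R] (Y : V → R)

theorem sum_indepAvoiding_mem {I N : Finset V} {v : V} (hv : v ∈ I) (hvN : v ∉ N) :
    ∑ K ∈ G.indepAvoiding I N with v ∈ K, ∏ i ∈ K, -Y i =
      -(Y v * G.indepPoly Y I (N ∪ G.closedNeighbors v)) := by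
  rw [indepPoly, ← neg_mul, Finset.mul_sum]
  refine Finset.sum_nbij' (fun K => K.erase v) (fun K => insert v K) ?_ ?_ ?_ ?_ ?_
  · intro K hK
    obtain ⟨h1, h2⟩ := Finset.mem_filter.1 hK
    exact G.erase_mem_indepAvoiding h2 h1
  · intro K hK
    exact Finset.mem_filter.2 ⟨(G.insert_mem_indepAvoiding hv hvN hK).2, by simp⟩
  · intro K hK
    exact Finset.insert_erase (Finset.mem_filter.1 hK).2
  · intro K hK
    exact Finset.erase_insert (G.insert_mem_indepAvoiding hv hvN hK).1
  · intro K hK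
    exact (Finset.mul_prod_erase _ _ (Finset.mem_filter.1 hK).2).symm

/-- Independent sets avoiding `N` are split according to whether they contain v; removing v from one
that does leaves a set avoiding its closed neighbourhood. The sign is what later makes all terms
nonnegative. -/
theorem indepPoly_insert {I N : Finset V} {v : V} (hv : v ∈ I) (hvN : v ∉ N) :
    G.indepPoly Y I (insert v N) =
      G.indepPoly Y I N + Y v * G.indepPoly Y I (N ∪ G.closedNeighbors v) := by
  have h : G.indepPoly Y I N = G.indepPoly Y I (insert v N) +
      -(Y v * G.indepPoly Y I (N ∪ G.closedNeighbors v)) := by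
    rw [← G.sum_indepAvoiding_mem Y hv hvN, indepPoly,
      ← Finset.sum_filter_not_add_sum_filter _ (fun K => v ∈ K)]
    congr 1
    refine Finset.sum_congr ?_ fun _ _ => rfl
    ext K
    simp only [Finset.mem_filter, mem_indepAvoiding, Finset.disjoint_insert_right]
    tauto
  rw [h]; ring

theorem indepPoly_insert_of_notMem {I N : Finset V} {v : V} (hv : v ∉ I) :
    G.indepPoly Y I (insert v N) = G.indepPoly Y I N := by
  refine Finset.sum_congr ?_ fun _ _ => rfl
  ext K
  simp only [mem_indepAvoiding, Finset.disjoint_insert_right]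
  have : K ⊆ I → v ∉ K := fun h h' => hv (h h')
  tauto

/-- Every nonempty union of connected components of the subgraph induced on `S` meets `N`. -/
def Meets (N S : Finset V) : Prop :=
  ∀ C ⊆ S, C.Nonempty → (∀ i ∈ C, ∀ j ∈ S, G.Adj i j → j ∈ C) → ∃ i ∈ C, i ∈ N

/-- A union of components of `S.erase v` either has a neighbour of v, and so meets the closed
neighbourhood, or is still a union of components of `S`. -/
theorem Meets.erase {G : SimpleGraph V} {N S : Finset V} {v : V} (h : G.Meets (insert v N) S) :
    G.Meets (N ∪ G.closedNeighbors v) (S.erase v) := by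
  intro C hC hne hcl
  by_cases hadj : ∃ i ∈ C, G.Adj i v
  · obtain ⟨i, hi, hiv⟩ := hadj
    exact ⟨i, hi, Finset.mem_union_right _ (G.mem_closedNeighbors.2 (Or.inr hiv.symm))⟩
  · push Not at hadj
    obtain ⟨i, hi, hiN⟩ := h C (hC.trans (Finset.erase_subset _ _)) hne fun i hi j hj hij =>
      hcl i hi j (Finset.mem_erase.2 ⟨by rintro rfl; exact hadj i hi hij, hj⟩) hij
    refine ⟨i, hi, Finset.mem_union_left _ (Finset.mem_of_mem_insert_of_ne hiN ?_)⟩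
    exact (Finset.mem_erase.1 (hC hi)).1

end SimpleGraph

/-! ### Positivity of the extremal coefficient of -log U. -/

namespace MvPowerSeries

variable {V : Type*} {G : SimpleGraph V} {I : Finset V} {m : V → ℕ} {U : MvPowerSeries V ℚ}

/-- `U` agrees with the signed independence polynomial of `G` on `I` in the variables `x_i ^ m i`,
up to monomials `d` with `m i < d i` for some `i`. -/
structure IsIndepLike (G : SimpleGraph V) (I : Finset V) (m : V → ℕ) (U : MvPowerSeries V ℚ) :
    Prop where
  pos : ∀ i, 0 < m i
  supported : SupportedAbove I m U
  coeff_indep : ∀ K ⊆ I, G.IsIndepSet K → coeff (restrictExp m K) U = (-1) ^ K.card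
  coeff_dep : ∀ K ⊆ I, ¬ G.IsIndepSet K → coeff (restrictExp m K) U = 0

theorem IsIndepLike.constantCoeff_eq (h : IsIndepLike G I m U) : constantCoeff U = 1 := by
  have := h.coeff_indep ∅ (by simp) (by simp [SimpleGraph.IsIndepSet])
  simpa [restrictExp] using this

theorem IsIndepLike.mul_inv (h : IsIndepLike G I m U) : U * U⁻¹ = 1 :=
  MvPowerSeries.mul_inv_cancel _ (by simp [h.constantCoeff_eq])

theorem IsIndepLike.supportedAbove_log (h : IsIndepLike G I m U) :
    SupportedAbove I m (-(PowerSeries.log ℚ).subst (U - 1)) := by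
  intro d hd
  exact (h.supported.sub .one).log_subst (by simp [h.constantCoeff_eq]) d (by simpa using hd)

variable [Fintype V] [DecidableEq V]

theorem coeff_indepPoly (hm : ∀ i, 0 < m i) (N K : Finset V) [Decidable (K ∈ G.indepAvoiding I N)] :
    coeff (restrictExp m K) (G.indepPoly (fun i => (X i : MvPowerSeries V ℚ) ^ m i) I N) =
      if K ∈ G.indepAvoiding I N then (-1) ^ K.card else 0 := by
  classical
  rw [SimpleGraph.indepPoly, map_sum]
  simp only [prod_neg_X_pow, coeff_monomial, (restrictExp_injective hm).eq_iff]
  rw [Finset.sum_ite_eq]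
  congr

theorem coeff_indepPoly_eq_zero {N : Finset V} {d : V →₀ ℕ} (h : ∀ K, d ≠ restrictExp m K) :
    coeff d (G.indepPoly (fun i => (X i : MvPowerSeries V ℚ) ^ m i) I N) = 0 := by
  classical
  rw [SimpleGraph.indepPoly, map_sum]
  refine Finset.sum_eq_zero fun K _ => ?_
  rw [prod_neg_X_pow, coeff_monomial, if_neg (h K)]

namespace IsIndepLike

theorem coeff_eq (h : IsIndepLike G I m U) {S : Finset V} {d : V →₀ ℕ}
    (hd : d ≤ restrictExp m S) :
    coeff d U = coeff d (G.indepPoly (fun i => (X i : MvPowerSeries V ℚ) ^ m i) I ∅) := by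
  classical
  by_cases hK : ∃ K, d = restrictExp m K
  · obtain ⟨K, rfl⟩ := hK
    rw [coeff_indepPoly h.pos]
    simp only [SimpleGraph.mem_indepAvoiding, Finset.disjoint_empty_right, and_true]
    by_cases hKI : K ⊆ I
    · by_cases hi : G.IsIndepSet K
      · simp [hKI, hi, h.coeff_indep K hKI hi]
      · simp [hi, h.coeff_dep K hKI hi]
    · rw [if_neg (by tauto)]
      by_contra hne
      refine hKI fun i hi => (h.supported _ hne i ?_).1
      rw [restrictExp_apply, if_pos hi]
      exact (h.pos i).ne'
  · push Not at hK
    rw [coeff_indepPoly_eq_zero hK]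
    by_contra hne
    exact hK _ (eq_restrictExp_of_le hd fun i hi => (h.supported d hne i hi).2)

theorem coeff_div_insert (h : IsIndepLike G I m U) {N S : Finset V} {v : V} (hvN : v ∉ N)
    (hS : S ⊆ I) :
    coeff (restrictExp m S)
        (G.indepPoly (fun i => (X i : MvPowerSeries V ℚ) ^ m i) I (insert v N) * U⁻¹) =
      coeff (restrictExp m S) (G.indepPoly (fun i => (X i : MvPowerSeries V ℚ) ^ m i) I N * U⁻¹) +
      if v ∈ S then coeff (restrictExp m (S.erase v)) (G.indepPoly
        (fun i => (X i : MvPowerSeries V ℚ) ^ m i) I (N ∪ G.closedNeighbors v) * U⁻¹) else 0 := by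
  by_cases hv : v ∈ I
  · rw [G.indepPoly_insert _ hv hvN, add_mul, map_add, mul_assoc, coeff_X_pow_mul _ _ _ (h.pos v)]
  · rw [G.indepPoly_insert_of_notMem _ hv, if_neg (fun h' => hv (hS h')), add_zero]

/-- Outer induction on `S`, inner on `N`. For empty `N` the quotient is U / U = 1 in the relevant
degrees; inserting v adds a coefficient at the smaller set `S.erase v`, which is positive by
`Meets.erase` when v ∈ S. -/
theorem coeff_div_pos (h : IsIndepLike G I m U) (S : Finset V) (hS : S ⊆ I) (N : Finset V) :
    0 ≤ coeff (restrictExp m S)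
        (G.indepPoly (fun i => (X i : MvPowerSeries V ℚ) ^ m i) I N * U⁻¹) ∧
      (G.Meets N S → 0 < coeff (restrictExp m S)
        (G.indepPoly (fun i => (X i : MvPowerSeries V ℚ) ^ m i) I N * U⁻¹)) := by
  induction S using Finset.strongInduction generalizing N with
  | H S ih =>
    induction N using Finset.induction_on with
    | empty =>
      have h1 : coeff (restrictExp m S)
          (G.indepPoly (fun i => (X i : MvPowerSeries V ℚ) ^ m i) I ∅ * U⁻¹) =
          if S = ∅ then 1 else 0 := by
        rw [← coeff_mul_congr_of_le fun d hd => h.coeff_eq hd, h.mul_inv, coeff_one]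
        have : (0 : V →₀ ℕ) = restrictExp m ∅ := by simp [restrictExp]
        simp only [this, (restrictExp_injective h.pos).eq_iff]
      rw [h1]
      refine ⟨by split_ifs <;> norm_num, fun hM => ?_⟩
      rw [if_pos]
      · norm_num
      by_contra hne
      obtain ⟨i, -, hi⟩ := hM S subset_rfl (Finset.nonempty_iff_ne_empty.2 hne) fun _ _ j hj _ => hj
      simp at hi
    | insert v N hvN ihN =>
      rw [h.coeff_div_insert hvN hS]
      by_cases hv : v ∈ S
      · rw [if_pos hv]
        have := ih _ (Finset.erase_ssubset hv) ((Finset.erase_subset _ _).trans hS)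
          (N ∪ G.closedNeighbors v)
        exact ⟨add_nonneg ihN.1 this.1, fun hM => add_pos_of_nonneg_of_pos ihN.1 (this.2 hM.erase)⟩
      · rw [if_neg hv, add_zero]
        refine ⟨ihN.1, fun hM => ihN.2 fun C hC hne hcl => ?_⟩
        obtain ⟨i, hi, hiN⟩ := hM C hC hne hcl
        refine ⟨i, hi, Finset.mem_of_mem_insert_of_ne hiN ?_⟩
        rintro rfl
        exact hv (hC hi)

/-- The Euler operator x_v ∂_v kills the independent sets avoiding v and multiplies the others by m
v. -/
theorem coeff_X_mul_pderiv_eq (h : IsIndepLike G I m U) {v : V} (hv : v ∈ I) {S : Finset V}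
    {d : V →₀ ℕ} (hd : d ≤ restrictExp m S) :
    coeff d (X v * pderiv ℚ v U) = coeff d (C (-(m v : ℚ)) * (X v ^ m v *
      G.indepPoly (fun i => (X i : MvPowerSeries V ℚ) ^ m i) I (G.closedNeighbors v))) := by
  classical
  have key := G.sum_indepAvoiding_mem (fun i => (X i : MvPowerSeries V ℚ) ^ m i) hv
    (Finset.notMem_empty v)
  rw [Finset.empty_union] at key
  rw [coeff_X_mul_pderiv, h.coeff_eq hd, map_neg, neg_mul, ← mul_neg, ← key, coeff_C_mul,
    SimpleGraph.indepPoly, map_sum, map_sum, Finset.sum_filter, Finset.mul_sum, Finset.mul_sum]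
  refine Finset.sum_congr rfl fun K _ => ?_
  rw [prod_neg_X_pow, coeff_monomial]
  split_ifs with h1 h2 h2
  · rw [h1, restrictExp_apply, if_pos h2]
  · rw [h1, restrictExp_apply, if_neg h2]
    simp
  · simp
  · simp

/-- This is the logarithmic derivative along v; the factor m v appears on both sides and cancels. -/
theorem mul_coeff_log (h : IsIndepLike G I m U) {v : V} (hv : v ∈ I) {S : Finset V} (hvS : v ∈ S) :
    coeff (restrictExp m S) (-(PowerSeries.log ℚ).subst (U - 1)) =
      coeff (restrictExp m (S.erase v)) (G.indepPoly
        (fun i => (X i : MvPowerSeries V ℚ) ^ m i) I (G.closedNeighbors v) * U⁻¹) := by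
  have h0 : constantCoeff (U - 1) = 0 := by simp [h.constantCoeff_eq]
  have h1 := one_add_mul_pderiv_log_subst h0 v
  rw [add_sub_cancel, map_sub, pderiv_one, sub_zero] at h1
  have h2 : X v * pderiv ℚ v ((PowerSeries.log ℚ).subst (U - 1)) =
      (X v * pderiv ℚ v U) * U⁻¹ := by
    rw [← h1]
    linear_combination (-X v * pderiv ℚ v ((PowerSeries.log ℚ).subst (U - 1))) * h.mul_inv
  have h3 := congrArg (coeff (restrictExp m S)) h2
  rw [coeff_X_mul_pderiv, coeff_mul_congr_of_le fun d hd => h.coeff_X_mul_pderiv_eq hv hd,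
    mul_assoc, coeff_C_mul, mul_assoc, coeff_X_pow_mul _ _ _ (h.pos v), if_pos hvS,
    restrictExp_apply, if_pos hvS] at h3
  have hm : (m v : ℚ) ≠ 0 := by exact_mod_cast (h.pos v).ne'
  rw [map_neg]
  apply mul_left_cancel₀ hm
  linear_combination -h3

/-- The coefficient of `∏ x_i ^ m i` in `-log U` is positive if the graph is connected. -/
theorem coeff_log_pos (h : IsIndepLike G I m U) (hne : I.Nonempty)
    (hconn : ∀ C ⊆ I, C.Nonempty → C ≠ I → ∃ i ∈ C, ∃ j ∈ I, j ∉ C ∧ G.Adj i j) :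
    0 < coeff (restrictExp m I) (-(PowerSeries.log ℚ).subst (U - 1)) := by
  obtain ⟨v, hv⟩ := hne
  rw [h.mul_coeff_log hv hv]
  refine (h.coeff_div_pos _ (Finset.erase_subset _ _) _).2 fun C hC hne hcl => ?_
  have hvC : v ∉ C := fun h' => by simpa using hC h'
  obtain ⟨i, hi, j, hj, hjC, hij⟩ := hconn C (hC.trans (Finset.erase_subset _ _)) hne
    (by rintro rfl; exact hvC hv)
  obtain rfl : j = v := by
    by_contra hjv
    exact hjC (hcl i hi j (Finset.mem_erase.2 ⟨hjv, hj⟩) hij)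
  exact ⟨i, hi, G.mem_closedNeighbors.2 (Or.inr hij.symm)⟩

end IsIndepLike

end MvPowerSeries

/-! ### Dihedral groups and rank two Cartan matrices. -/

section AlternatingProd

variable {G : Type*}

/-- The `k`-th entry of the alternating sequence `s, t, s, …`. -/
def alternatingLetter (s t : G) (k : ℕ) : G := if k % 2 = 0 then s else t

theorem alternatingLetter_succ (s t : G) (k : ℕ) :
    alternatingLetter s t (k + 1) = alternatingLetter t s k := by
  unfold alternatingLetter
  split_ifs <;> first | rfl | omega

theorem eq_alternatingLetter {s t x : G} (h : x = s ∨ x = t) (k : ℕ) :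
    x = alternatingLetter s t k ∨ x = alternatingLetter t s k := by
  unfold alternatingLetter
  split_ifs <;> tauto

variable [Group G] {s t : G}

/-- The alternating product `⋯ t * s * t * s` with `k` factors. -/
def alternatingProd (s t : G) : ℕ → G
  | 0 => 1
  | k + 1 => alternatingLetter s t k * alternatingProd s t k

theorem alternatingLetter_mul_alternatingProd_succ (hs : s * s = 1) (ht : t * t = 1) (k : ℕ) :
    alternatingLetter s t k * alternatingProd s t (k + 1) = alternatingProd s t k := by
  rw [alternatingProd, alternatingLetter]
  split_ifs <;> simp [← mul_assoc, hs, ht]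

/-- A new letter either lengthens the word or cancels its leading letter; at length `M` the braid
relation exchanges the leading letter, turning lengthening into cancellation. -/
theorem exists_mul_alternatingProd (hs : s * s = 1) (ht : t * t = 1) {M : ℕ∞} (hM : 1 ≤ M)
    (hbraid : ∀ k : ℕ, (k : ℕ∞) = M → alternatingProd s t k = alternatingProd t s k)
    {x : G} (hx : x = s ∨ x = t) {k : ℕ} (hk : (k : ℕ∞) ≤ M) :
    ∃ l : ℕ, (l : ℕ∞) ≤ M ∧ (x * alternatingProd s t k = alternatingProd s t l ∨
      x * alternatingProd s t k = alternatingProd t s l) := by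
  rcases eq_alternatingLetter hx k with rfl | rfl
  · rcases hk.lt_or_eq with hlt | heq
    · exact ⟨k + 1, by exact_mod_cast Order.add_one_le_of_lt hlt, Or.inl rfl⟩
    · rcases k with _ | k
      · exact absurd hM (by rw [← heq]; simp)
      · rw [hbraid _ heq, alternatingLetter_succ, alternatingLetter_mul_alternatingProd_succ ht hs]
        exact ⟨k, le_trans (by exact_mod_cast Nat.le_succ k) hk, Or.inr rfl⟩
  · rcases k with _ | k
    · exact ⟨1, by exact_mod_cast hM, Or.inr rfl⟩
    · rw [alternatingLetter_succ, alternatingLetter_mul_alternatingProd_succ hs ht]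
      exact ⟨k, le_trans (by exact_mod_cast Nat.le_succ k) hk, Or.inl rfl⟩

theorem exists_alternatingProd_of_mem_closure (hs : s * s = 1) (ht : t * t = 1) {M : ℕ∞}
    (hM : 1 ≤ M) (hbraid : ∀ k : ℕ, (k : ℕ∞) = M → alternatingProd s t k = alternatingProd t s k)
    {g : G} (hg : g ∈ Subgroup.closure {s, t}) :
    ∃ k : ℕ, (k : ℕ∞) ≤ M ∧ (g = alternatingProd s t k ∨ g = alternatingProd t s k) := by
  have key : ∀ x : G, (x = s ∨ x = t) → ∀ y : G,
      (∃ k : ℕ, (k : ℕ∞) ≤ M ∧ (y = alternatingProd s t k ∨ y = alternatingProd t s k)) →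
      ∃ k : ℕ, (k : ℕ∞) ≤ M ∧ (x * y = alternatingProd s t k ∨ x * y = alternatingProd t s k) := by
    rintro x hx y ⟨k, hk, rfl | rfl⟩
    · exact exists_mul_alternatingProd hs ht hM hbraid hx hk
    · obtain ⟨l, hl, h⟩ := exists_mul_alternatingProd ht hs hM (fun k hk => (hbraid k hk).symm)
        hx.symm hk
      exact ⟨l, hl, h.symm⟩
  induction hg using Subgroup.closure_induction_left with
  | one => exact ⟨0, by simp, Or.inl rfl⟩
  | mul_left x hx y hy ih => exact key x hx y ih
  | inv_mul_cancel x hx y hy ih =>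
    have : x⁻¹ = x := by rcases hx with rfl | rfl <;> exact inv_eq_of_mul_eq_one_left ‹_›
    rw [this]
    exact key x hx y ih

end AlternatingProd

/-- The pair of levels obtained from `(p, q)` by `k` alternating simple reflections in a rank two
root system with off-diagonal Cartan entries `-a`, `-b`; the first component is the level of the
next reflection to be applied. -/
def dihedralLevels (a b p q : ℤ) : ℕ → ℤ × ℤ
  | 0 => (p, q)
  | k + 1 => ((dihedralLevels a b p q k).2 +
      alternatingLetter a b k * (dihedralLevels a b p q k).1, -(dihedralLevels a b p q k).1)

theorem dihedralLevels_pos_of_four_le {a b p q : ℤ} (ha : 0 < a) (hb : 0 < b) (hab : 4 ≤ a * b)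
    (hp : 0 < p) (hq : 0 < q) (k : ℕ) : 0 < (dihedralLevels a b p q k).1 := by
  -- For levels (x, y) and current coefficient c, the invariant c x + 2 y ≥ 0 gives y + c x ≥ c x /
  -- 2 > 0, and it propagates because the product of the two coefficients is at least 4.
  suffices h : 0 < (dihedralLevels a b p q k).1 ∧
      0 ≤ alternatingLetter a b k * (dihedralLevels a b p q k).1 +
        2 * (dihedralLevels a b p q k).2 from h.1
  induction k with
  | zero =>
    simp only [dihedralLevels, alternatingLetter]
    exact ⟨hp, by simp; positivity⟩
  | succ k ih =>
    obtain ⟨h1, h2⟩ := ih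
    rw [alternatingLetter_succ, dihedralLevels]
    have hc : 0 < alternatingLetter a b k ∧ 0 < alternatingLetter b a k ∧
        4 ≤ alternatingLetter b a k * alternatingLetter a b k := by
      unfold alternatingLetter
      split_ifs
      exacts [⟨ha, hb, by linarith⟩, ⟨hb, ha, by linarith⟩]
    obtain ⟨hc1, hc2, hc3⟩ := hc
    generalize alternatingLetter a b k = c at *
    generalize alternatingLetter b a k = d at *
    generalize (dihedralLevels a b p q k).1 = x at *
    generalize (dihedralLevels a b p q k).2 = y at *
    have h3 : 0 < c * x := mul_pos hc1 h1
    refine ⟨by dsimp only; linarith, ?_⟩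
    dsimp only
    nlinarith [mul_nonneg hc2.le h2, mul_le_mul_of_nonneg_right hc3 h1.le]

/-- The order of a product of two simple reflections with off-diagonal Cartan entries
`-a`, `-b`. -/
def dihedralOrder (a b : ℤ) : ℕ∞ :=
  if a * b = 0 then 2 else if a * b = 1 then 3 else if a * b = 2 then 4 else
    if a * b = 3 then 6 else ⊤

theorem dihedralOrder_comm (a b : ℤ) : dihedralOrder a b = dihedralOrder b a := by
  rw [dihedralOrder, dihedralOrder, mul_comm]

theorem one_le_dihedralOrder (a b : ℤ) : 1 ≤ dihedralOrder a b := by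
  unfold dihedralOrder
  split_ifs <;> norm_num

/-- The types A₁ × A₁, A₂, B₂ and G₂ in both orientations, and the infinite dihedral case. -/
theorem rank_two_cases {a b : ℤ} (ha : 0 ≤ a) (hb : 0 ≤ b) (hab : a = 0 ↔ b = 0) :
    (a = 0 ∧ b = 0) ∨ (a = 1 ∧ b = 1) ∨ (a = 1 ∧ b = 2) ∨ (a = 2 ∧ b = 1) ∨ (a = 1 ∧ b = 3) ∨
      (a = 3 ∧ b = 1) ∨ (0 < a ∧ 0 < b ∧ 4 ≤ a * b) := by
  rcases ha.eq_or_lt with rfl | ha'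
  · exact Or.inl ⟨rfl, hab.1 rfl⟩
  · have hb' : 0 < b := lt_of_le_of_ne hb fun h => ha'.ne' (hab.2 h.symm)
    by_cases h4 : 4 ≤ a * b
    · tauto
    · have h1 : a < 4 := by nlinarith
      have h2 : b < 4 := by nlinarith
      interval_cases a <;> interval_cases b <;> simp_all

theorem dihedralLevels_pos {a b p q : ℤ} (ha : 0 ≤ a) (hb : 0 ≤ b) (hab : a = 0 ↔ b = 0)
    (hp : 0 < p) (hq : 0 < q) {k : ℕ} (hk : (k : ℕ∞) < dihedralOrder a b) :
    0 < (dihedralLevels a b p q k).1 := by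
  rcases rank_two_cases ha hb hab with
    ⟨rfl, rfl⟩ | ⟨rfl, rfl⟩ | ⟨rfl, rfl⟩ | ⟨rfl, rfl⟩ | ⟨rfl, rfl⟩ | ⟨rfl, rfl⟩ | ⟨h1, h2, h3⟩
  iterate 6
    · simp only [dihedralOrder] at hk
      norm_num at hk
      interval_cases k <;> simp [dihedralLevels, alternatingLetter] <;> linarith
  · exact dihedralLevels_pos_of_four_le h1 h2 h3 hp hq k

namespace GCM.Realization

variable {n : ℕ} {A : GCM n} {H : Type*} [AddCommGroup H] [Module ℂ H] (R : A.Realization H)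

theorem simpleReflection_mul_self (i : Fin n) :
    R.simpleReflection i * R.simpleReflection i = 1 := by
  ext ν : 1
  exact Module.involutive_reflection (R.eval_coroot_root i) ν

theorem simpleReflection_sub_smul {i j : Fin n} {a : ℤ} (ha : A.entry i j = -a) (ν : Dual ℂ H)
    (u v : ℂ) :
    R.simpleReflection i (ν - u • R.root i - v • R.root j) =
      ν - (ν (R.coroot i) - u + a * v) • R.root i - v • R.root j := by
  rw [simpleReflection_apply]
  simp only [LinearMap.sub_apply, LinearMap.smul_apply, R.pairing, A.diag, ha, smul_eq_mul]
  push_cast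
  module

theorem simpleReflection_sub_smul' {i j : Fin n} {a : ℤ} (ha : A.entry j i = -a) (ν : Dual ℂ H)
    (u v : ℂ) :
    R.simpleReflection j (ν - u • R.root i - v • R.root j) =
      ν - u • R.root i - (ν (R.coroot j) - v + a * u) • R.root j := by
  rw [sub_right_comm, R.simpleReflection_sub_smul ha, sub_right_comm]

theorem alternatingProd_comm {i j : Fin n} (hij : i ≠ j) {k : ℕ}
    (hk : (k : ℕ∞) = dihedralOrder (-A.entry j i) (-A.entry i j)) :
    alternatingProd (R.simpleReflection i) (R.simpleReflection j) k =
      alternatingProd (R.simpleReflection j) (R.simpleReflection i) k := by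
  have ha := A.nonpos j i hij.symm
  have hb := A.nonpos i j hij
  have hi := R.simpleReflection_sub_smul (i := i) (j := j) (a := -A.entry i j) (by simp)
  have hj := R.simpleReflection_sub_smul' (i := i) (j := j) (a := -A.entry j i) (by simp)
  have hab : -A.entry j i = 0 ↔ -A.entry i j = 0 := by simpa using A.zero_iff j i
  ext ν : 1
  -- In this shape `hi` and `hj` can be iterated, so each finite type becomes a polynomial identity
  -- in the coefficients.
  rw [show ν = ν - (0 : ℂ) • R.root i - (0 : ℂ) • R.root j by simp]
  replace ha : 0 ≤ -A.entry j i := by omega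
  replace hb : 0 ≤ -A.entry i j := by omega
  generalize -A.entry i j = b at *
  generalize -A.entry j i = a at *
  rcases rank_two_cases ha hb hab with
    ⟨rfl, rfl⟩ | ⟨rfl, rfl⟩ | ⟨rfl, rfl⟩ | ⟨rfl, rfl⟩ | ⟨rfl, rfl⟩ | ⟨rfl, rfl⟩ | ⟨h1, h2, h3⟩
  iterate 6
    · norm_num [dihedralOrder] at hk
      obtain rfl : k = _ := by exact_mod_cast hk
      simp only [alternatingProd, alternatingLetter, Nat.zero_mod, Nat.one_mod, Nat.reduceMod,
        if_true, if_false, one_ne_zero, LinearEquiv.mul_apply, mul_one, hi, hj]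
      congr 2 <;> [congr 1; skip] <;> push_cast <;> ring_nf
  · simp [dihedralOrder, show a * b ≠ 0 by omega, show a * b ≠ 1 by omega,
      show a * b ≠ 2 by omega, show a * b ≠ 3 by omega] at hk

end GCM.Realization

/-! ### Descents of a regular dominant weight under W_I. -/

namespace GCM

variable {n : ℕ}

/-- The value on the `i`-th simple coroot of a weight lying `∑ c j • α_j` below a weight whose
value there is `m i`. -/
def level (A : GCM n) (m : Fin n → ℕ) (c : Fin n → ℤ) (i : Fin n) : ℤ :=
  m i - ∑ j, A.entry i j * c j

theorem level_add_single (A : GCM n) (m : Fin n → ℕ) (c : Fin n → ℤ) (i j : Fin n) (x : ℤ) :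
    A.level m (c + Pi.single j x) i = A.level m c i - A.entry i j * x := by
  simp only [level, Pi.add_apply, mul_add, Finset.sum_add_distrib]
  rw [Finset.sum_eq_single j (fun k _ hk => by simp [hk]) (by simp) (f := fun k =>
    A.entry i k * (Pi.single j x : Fin n → ℤ) k)]
  simp only [Pi.single_eq_same]
  ring

theorem level_add_single_self (A : GCM n) (m : Fin n → ℕ) (c : Fin n → ℤ) (i : Fin n) :
    A.level m (c + Pi.single i (A.level m c i)) i = -A.level m c i := by
  rw [level_add_single, A.diag]; ring

namespace Realization

variable {A : GCM n} {H : Type*} [AddCommGroup H] [Module ℂ H] (R : A.Realization H)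
  (I : Finset (Fin n)) (m : Fin n → ℕ)

/-- `w` is a product of simple reflections in `I` that successively lower a weight with values
`m i` on the simple coroots in `I`, the total decrease being `∑ c j • α_j`. -/
inductive Descent : (Dual ℂ H ≃ₗ[ℂ] Dual ℂ H) → (Fin n → ℤ) → Prop
  | one : Descent 1 0
  | step {w : Dual ℂ H ≃ₗ[ℂ] Dual ℂ H} {c : Fin n → ℤ} {i : Fin n} (h : Descent w c) (hi : i ∈ I)
      (hpos : 0 < A.level m c i) :
      Descent (R.simpleReflection i * w) (c + Pi.single i (A.level m c i))

variable {R I m}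

theorem simpleReflection_lower {Λ : Dual ℂ H} (c : Fin n → ℤ) {i : Fin n}
    (hΛ : Λ (R.coroot i) = m i) :
    R.simpleReflection i (Λ - ∑ j, (c j : ℂ) • R.root j) =
      Λ - ∑ j, (((c + Pi.single i (A.level m c i) : Fin n → ℤ) j : ℤ) : ℂ) • R.root j := by
  rw [simpleReflection_apply]
  have h1 : (Λ - ∑ j, (c j : ℂ) • R.root j) (R.coroot i) = (A.level m c i : ℂ) := by
    simp [level, hΛ, LinearMap.sum_apply, R.pairing, mul_comm]
  rw [h1]
  simp only [Pi.add_apply, Int.cast_add, add_smul, Finset.sum_add_distrib]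
  rw [Finset.sum_eq_single i (fun k _ hk => by simp [hk]) (by simp) (f := fun k =>
    (((Pi.single i (A.level m c i) : Fin n → ℤ) k : ℤ) : ℂ) • R.root k)]
  simp only [Pi.single_eq_same]
  abel

theorem eq_of_sum_smul_root_eq {c d : Fin n → ℤ}
    (h : ∑ j, (c j : ℂ) • R.root j = ∑ j, (d j : ℂ) • R.root j) : c = d := by
  have h1 : ∑ j, ((c j : ℂ) - d j) • R.root j = 0 := by
    simp [sub_smul, h]
  have h2 := Fintype.linearIndependent_iff.1 R.root_linearIndependent _ h1
  ext j
  exact_mod_cast sub_eq_zero.1 (h2 j)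

namespace Descent

theorem mem_parabolicWeyl {w : Dual ℂ H ≃ₗ[ℂ] Dual ℂ H} {c : Fin n → ℤ}
    (h : R.Descent I m w c) : w ∈ R.parabolicWeyl I := by
  induction h with
  | one => exact one_mem _
  | step h hi hpos ih => exact mul_mem (Subgroup.subset_closure ⟨_, hi, rfl⟩) ih

theorem nonneg {w : Dual ℂ H ≃ₗ[ℂ] Dual ℂ H} {c : Fin n → ℤ} (h : R.Descent I m w c) :
    0 ≤ c := by
  induction h with
  | one => exact le_rfl
  | step h hi hpos ih => exact add_nonneg ih (Pi.single_nonneg.2 hpos.le)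

/-- The weight reached by a descent. -/
theorem apply_eq {Λ : Dual ℂ H} (hΛ : ∀ i ∈ I, Λ (R.coroot i) = m i)
    {w : Dual ℂ H ≃ₗ[ℂ] Dual ℂ H} {c : Fin n → ℤ} (h : R.Descent I m w c) :
    w Λ = Λ - ∑ j, (c j : ℂ) • R.root j := by
  induction h with
  | one => simp
  | step h hi hpos ih => rw [LinearEquiv.mul_apply, ih, simpleReflection_lower _ (hΛ _ hi)]

theorem unique {Λ : Dual ℂ H} (hΛ : ∀ i ∈ I, Λ (R.coroot i) = m i)
    {w : Dual ℂ H ≃ₗ[ℂ] Dual ℂ H} {c d : Fin n → ℤ} (h : R.Descent I m w c)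
    (h' : R.Descent I m w d) : c = d := by
  have := (h.apply_eq hΛ).symm.trans (h'.apply_eq hΛ)
  exact eq_of_sum_smul_root_eq (R := R) (sub_right_injective this)

theorem eq_one_of_zero {w : Dual ℂ H ≃ₗ[ℂ] Dual ℂ H} {c : Fin n → ℤ} (h : R.Descent I m w c)
    (hc : c = 0) : w = 1 := by
  cases h with
  | one => rfl
  | @step w c i h hi hpos =>
    have h1 := h.nonneg i
    have h2 := congrFun hc i
    simp only [Pi.add_apply, Pi.single_eq_same, Pi.zero_apply] at h1 h2
    omega

/-- In a rank two parabolic coset, descending alternately from a weight that is dominant for both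
simple coroots. -/
theorem alternating {i j : Fin n} (hi : i ∈ I) (hj : j ∈ I)
    {w : Dual ℂ H ≃ₗ[ℂ] Dual ℂ H} {c : Fin n → ℤ} (h : R.Descent I m w c) {k : ℕ}
    (hk : ∀ l < k, 0 < (dihedralLevels (-A.entry j i) (-A.entry i j) (A.level m c i)
      (A.level m c j) l).1) :
    ∃ d, R.Descent I m (alternatingProd (R.simpleReflection i) (R.simpleReflection j) k * w) d ∧
      A.level m d (alternatingLetter i j k) = (dihedralLevels (-A.entry j i) (-A.entry i j)
        (A.level m c i) (A.level m c j) k).1 ∧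
      A.level m d (alternatingLetter j i k) = (dihedralLevels (-A.entry j i) (-A.entry i j)
        (A.level m c i) (A.level m c j) k).2 := by
  induction k with
  | zero => exact ⟨c, by simpa [alternatingProd] using h, rfl, rfl⟩
  | succ k ih =>
    obtain ⟨d, hd, h1, h2⟩ := ih fun l hl => hk l (by omega)
    have hpos := hk k (by omega)
    rw [← h1] at hpos
    have hmem : alternatingLetter i j k ∈ I := by
      unfold alternatingLetter; split_ifs <;> assumption
    refine ⟨d + Pi.single (alternatingLetter i j k) (A.level m d (alternatingLetter i j k)),
      ?_, ?_, ?_⟩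
    rotate_left
    · rw [alternatingLetter_succ, level_add_single, dihedralLevels, ← h1, h2]
      dsimp only
      rw [sub_eq_add_neg, ← neg_mul]
      congr 2
      unfold alternatingLetter
      split_ifs <;> rfl
    · rw [alternatingLetter_succ, level_add_single_self, dihedralLevels, h1]
    · convert hd.step hmem hpos using 1
      rw [alternatingProd, mul_assoc]
      congr 1
      unfold alternatingLetter
      split_ifs <;> rfl

theorem alternating_of_le_order {Λ : Dual ℂ H} (hΛ : ∀ i ∈ I, Λ (R.coroot i) = m i)
    {i j : Fin n} (hij : i ≠ j) (hi : i ∈ I) (hj : j ∈ I)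
    {w : Dual ℂ H ≃ₗ[ℂ] Dual ℂ H} {c : Fin n → ℤ} (h : R.Descent I m w c)
    (hci : 0 < A.level m c i) (hcj : 0 < A.level m c j) {k : ℕ}
    (hk : (k : ℕ∞) ≤ dihedralOrder (-A.entry j i) (-A.entry i j)) :
    ∃ d, R.Descent I m (alternatingProd (R.simpleReflection i) (R.simpleReflection j) k * w) d ∧
      A.level m d i ≠ 0 ∧ A.level m d j ≠ 0 := by
  have hab : -A.entry j i = 0 ↔ -A.entry i j = 0 := by simpa using A.zero_iff j i
  have ha : 0 ≤ -A.entry j i := by have := A.nonpos j i hij.symm; omega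
  have hb : 0 ≤ -A.entry i j := by have := A.nonpos i j hij; omega
  have hlev : ∀ l : ℕ, (l : ℕ∞) < dihedralOrder (-A.entry j i) (-A.entry i j) →
      0 < (dihedralLevels (-A.entry j i) (-A.entry i j) (A.level m c i) (A.level m c j) l).1 :=
    fun l hl => dihedralLevels_pos ha hb hab hci hcj hl
  have hlev' : ∀ l : ℕ, (l : ℕ∞) < dihedralOrder (-A.entry j i) (-A.entry i j) →
      0 < (dihedralLevels (-A.entry i j) (-A.entry j i) (A.level m c j) (A.level m c i) l).1 :=
    fun l hl => dihedralLevels_pos hb ha hab.symm hcj hci (by rwa [dihedralOrder_comm])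
  have hlt : ∀ l < k, (l : ℕ∞) < dihedralOrder (-A.entry j i) (-A.entry i j) :=
    fun l hl => lt_of_lt_of_le (by exact_mod_cast hl) hk
  obtain ⟨d, hd, h1, h2⟩ := h.alternating hi hj (k := k) fun l hl => hlev l (hlt l hl)
  have hne2 : A.level m d (alternatingLetter j i k) ≠ 0 := by
    rw [h2]
    rcases k with _ | k
    · exact hcj.ne'
    · exact (neg_neg_of_pos (hlev k (hlt k (by omega)))).ne
  -- At k equal to the order, positivity no longer covers the next letter. By the braid relation the
  -- same element is the word starting with j, for which this letter was the last one applied.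
  have hne1 : A.level m d (alternatingLetter i j k) ≠ 0 := by
    rcases hk.lt_or_eq with hk' | hk'
    · rw [h1]; exact (hlev k hk').ne'
    · obtain ⟨d', hd', -, h2'⟩ := h.alternating hj hi (k := k) fun l hl => hlev' l (hlt l hl)
      rw [← R.alternatingProd_comm hij hk'] at hd'
      rw [hd.unique hΛ hd', h2']
      rcases k with _ | k
      · exact hci.ne'
      · exact (neg_neg_of_pos (hlev' k (hlt k (by omega)))).ne
  refine ⟨d, hd, ?_⟩
  rcases eq_alternatingLetter (Or.inl rfl : i = i ∨ i = j) k with hi' | hi' <;>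
  rcases eq_alternatingLetter (Or.inr rfl : j = i ∨ j = j) k with hj' | hj'
  · exact absurd (hi'.trans hj'.symm) hij
  · rw [← hi'] at hne1; rw [← hj'] at hne2; exact ⟨hne1, hne2⟩
  · rw [← hj'] at hne1; rw [← hi'] at hne2; exact ⟨hne2, hne1⟩
  · exact absurd (hi'.trans hj'.symm) hij

theorem rank_two {Λ : Dual ℂ H} (hΛ : ∀ i ∈ I, Λ (R.coroot i) = m i)
    {i j : Fin n} (hij : i ≠ j) (hi : i ∈ I) (hj : j ∈ I)
    {w : Dual ℂ H ≃ₗ[ℂ] Dual ℂ H} {c : Fin n → ℤ} (h : R.Descent I m w c)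
    (hci : 0 < A.level m c i) (hcj : 0 < A.level m c j) {g : Dual ℂ H ≃ₗ[ℂ] Dual ℂ H}
    (hg : g ∈ Subgroup.closure {R.simpleReflection i, R.simpleReflection j}) :
    ∃ d, R.Descent I m (g * w) d ∧ A.level m d i ≠ 0 ∧ A.level m d j ≠ 0 := by
  obtain ⟨k, hk, rfl | rfl⟩ := exists_alternatingProd_of_mem_closure
    (R.simpleReflection_mul_self i) (R.simpleReflection_mul_self j)
    (one_le_dihedralOrder (-A.entry j i) (-A.entry i j))
    (fun k hk => R.alternatingProd_comm hij hk) hg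
  · exact h.alternating_of_le_order hΛ hij hi hj hci hcj hk
  · obtain ⟨d, hd, h1, h2⟩ := h.alternating_of_le_order hΛ hij.symm hj hi hcj hci
      (by rwa [dihedralOrder_comm])
    exact ⟨d, hd, h2, h1⟩

/-- Left multiplication by a simple reflection in `I` preserves the set of descents. -/
def Stable (R : A.Realization H) (I : Finset (Fin n)) (m : Fin n → ℕ)
    (w : Dual ℂ H ≃ₗ[ℂ] Dual ℂ H) (c : Fin n → ℤ) : Prop :=
  ∀ i ∈ I, A.level m c i ≠ 0 ∧ ∃ d, R.Descent I m (R.simpleReflection i * w) d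

theorem apply_mul_eq {Λ : Dual ℂ H} (hΛ : ∀ i ∈ I, Λ (R.coroot i) = m i)
    {w : Dual ℂ H ≃ₗ[ℂ] Dual ℂ H} {c d : Fin n → ℤ} (h : R.Descent I m w c) {i : Fin n}
    (hi : i ∈ I) (h' : R.Descent I m (R.simpleReflection i * w) d) :
    d = c + Pi.single i (A.level m c i) := by
  have h1 := h'.apply_eq hΛ
  rw [LinearEquiv.mul_apply, h.apply_eq hΛ, simpleReflection_lower _ (hΛ _ hi)] at h1
  exact (eq_of_sum_smul_root_eq (R := R) (sub_right_injective h1)).symm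

/-- Ascend inside a rank two parabolic coset to a weight dominant for both simple coroots. -/
theorem exists_dominant {Λ : Dual ℂ H} (hΛ : ∀ i ∈ I, Λ (R.coroot i) = m i) {i j : Fin n}
    (hi : i ∈ I) (hj : j ∈ I) (N : ℤ)
    (hN : ∀ w c, R.Descent I m w c → ∑ k, c k < N → Stable R I m w c) (t : ℕ)
    {w : Dual ℂ H ≃ₗ[ℂ] Dual ℂ H} {c : Fin n → ℤ} (h : R.Descent I m w c)
    (ht : ∑ k, c k = t) (htN : (t : ℤ) < N) :
    ∃ w₀ c₀, R.Descent I m w₀ c₀ ∧ 0 < A.level m c₀ i ∧ 0 < A.level m c₀ j ∧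
      w * w₀⁻¹ ∈ Subgroup.closure {R.simpleReflection i, R.simpleReflection j} := by
  induction t using Nat.strong_induction_on generalizing w c with
  | _ t ih =>
    have hst := hN w c h (by omega)
    -- Reflecting in a negative level raises the weight, so the total decrease drops and the
    -- induction applies.
    have up : ∀ k ∈ I, (k = i ∨ k = j) → A.level m c k < 0 →
        ∃ w₀ c₀, R.Descent I m w₀ c₀ ∧ 0 < A.level m c₀ i ∧ 0 < A.level m c₀ j ∧
          w * w₀⁻¹ ∈ Subgroup.closure {R.simpleReflection i, R.simpleReflection j} := by
      intro k hk hkij hneg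
      obtain ⟨d, hd⟩ := (hst k hk).2
      have hsum : ∑ l, d l = t + A.level m c k := by
        rw [h.apply_mul_eq hΛ hk hd]
        simp [Finset.sum_add_distrib, ht]
      have hd0 : 0 ≤ ∑ l, d l := Finset.sum_nonneg fun l _ => hd.nonneg l
      obtain ⟨w₀, c₀, h0, h1, h2, h3⟩ := ih (t + A.level m c k).toNat (by omega) hd (by omega)
        (by omega)
      refine ⟨w₀, c₀, h0, h1, h2, ?_⟩
      have hk' : R.simpleReflection k ∈
          Subgroup.closure {R.simpleReflection i, R.simpleReflection j} := by
        apply Subgroup.subset_closure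
        rcases hkij with rfl | rfl <;> simp
      have := mul_mem hk' h3
      rwa [← mul_assoc, ← mul_assoc, R.simpleReflection_mul_self, one_mul] at this
    rcases lt_or_gt_of_ne (hst i hi).1 with hi' | hi'
    · exact up i hi (Or.inl rfl) hi'
    rcases lt_or_gt_of_ne (hst j hj).1 with hj' | hj'
    · exact up j hj (Or.inr rfl) hj'
    exact ⟨w, c, h, hi', hj', by simp⟩

/-- Induction on the total decrease. If the last step used j ≠ i, the element before it is moved up
within its ⟨s_i, s_j⟩-coset to some w₀ dominant for i and j; both w and s_i w lie in ⟨s_i, s_j⟩ w₀,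
where `rank_two` applies. -/
theorem stable {Λ : Dual ℂ H} (hΛ : ∀ i ∈ I, Λ (R.coroot i) = m i) (hm : ∀ i, 0 < m i) (t : ℕ)
    {w : Dual ℂ H ≃ₗ[ℂ] Dual ℂ H} {c : Fin n → ℤ} (h : R.Descent I m w c)
    (ht : ∑ k, c k = t) : Stable R I m w c := by
  induction t using Nat.strong_induction_on generalizing w c with
  | _ t ih =>
    intro i hi
    cases h with
    | one =>
      have h0 : A.level m 0 i = m i := by simp [level]
      have := hm i
      refine ⟨by rw [h0]; omega, _, Descent.one.step hi (by rw [h0]; omega)⟩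
    | @step w c j h hj hpos =>
      have hsum : ∑ k, c k = t - A.level m c j := by
        simp only [Pi.add_apply, Finset.sum_add_distrib, Finset.sum_pi_single', Finset.mem_univ,
          if_true] at ht
        omega
      by_cases hij : i = j
      · subst hij
        refine ⟨by rw [level_add_single_self]; omega, c, ?_⟩
        rwa [← mul_assoc, R.simpleReflection_mul_self, one_mul]
      · have hc0 : 0 ≤ ∑ l, c l := Finset.sum_nonneg fun l _ => h.nonneg l
        obtain ⟨w₀, c₀, h0, h1, h2, h3⟩ := exists_dominant hΛ hi hj t
          (fun w' c' h' hlt => ih (∑ k, c' k).toNat (by omega) h'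
            (by rw [Int.toNat_of_nonneg (Finset.sum_nonneg fun l _ => h'.nonneg l)]))
          (t - A.level m c j).toNat h (by omega) (by omega)
        have hmem : ∀ k, k = i ∨ k = j → R.simpleReflection k ∈
            Subgroup.closure {R.simpleReflection i, R.simpleReflection j} := by
          rintro k (rfl | rfl) <;> exact Subgroup.subset_closure (by simp)
        have h4 := mul_mem (hmem j (Or.inr rfl)) h3
        obtain ⟨d, hd, hd1, -⟩ := h0.rank_two hΛ hij hi hj h1 h2 h4
        obtain ⟨e, he, -, -⟩ := h0.rank_two hΛ hij hi hj h1 h2 (mul_mem (hmem i (Or.inl rfl)) h4)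
        simp only [mul_assoc, inv_mul_cancel, mul_one] at hd he
        rw [hd.unique hΛ (h.step hj hpos)] at hd1
        exact ⟨hd1, e, he⟩

theorem exists_of_mem {Λ : Dual ℂ H} (hΛ : ∀ i ∈ I, Λ (R.coroot i) = m i) (hm : ∀ i, 0 < m i)
    {w : Dual ℂ H ≃ₗ[ℂ] Dual ℂ H} (hw : w ∈ R.parabolicWeyl I) : ∃ c, R.Descent I m w c := by
  have key : ∀ x ∈ R.simpleReflection '' I, ∀ y, (∃ c, R.Descent I m y c) →
      ∃ c, R.Descent I m (x * y) c := by
    rintro _ ⟨i, hi, rfl⟩ y ⟨c, hc⟩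
    exact (hc.stable hΛ hm (∑ k, c k).toNat
      (by rw [Int.toNat_of_nonneg (Finset.sum_nonneg fun l _ => hc.nonneg l)]) i hi).2
  induction hw using Subgroup.closure_induction_left with
  | one => exact ⟨0, .one⟩
  | mul_left x hx y hy ih => exact key x hx y ih
  | inv_mul_cancel x hx y hy ih =>
    have : x⁻¹ = x := by
      obtain ⟨i, -, rfl⟩ := hx
      exact inv_eq_of_mul_eq_one_left (R.simpleReflection_mul_self i)
    rw [this]
    exact key x hx y ih

end Descent

end Realization

end GCM

/-! ### The numerator as an independence polynomial in extremal degrees. -/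

namespace GCM

variable {n : ℕ}

theorem entry_mul_nonpos (A : GCM n) {c : Fin n → ℤ} (hc : 0 ≤ c) {i : Fin n} (hi : c i = 0)
    (j : Fin n) : A.entry i j * c j ≤ 0 := by
  by_cases hij : i = j
  · rw [← hij, hi, mul_zero]
  · exact mul_nonpos_of_nonpos_of_nonneg (A.nonpos i j hij) (hc j)

theorem le_level (A : GCM n) (m : Fin n → ℕ) {c : Fin n → ℤ} (hc : 0 ≤ c) {i : Fin n}
    (hi : c i = 0) : m i ≤ A.level m c i := by
  have := Finset.sum_nonpos fun j (_ : j ∈ Finset.univ) => A.entry_mul_nonpos hc hi j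
  rw [level]; omega

theorem level_eq_iff (A : GCM n) (m : Fin n → ℕ) {c : Fin n → ℤ} (hc : 0 ≤ c) {i : Fin n}
    (hi : c i = 0) : A.level m c i = m i ↔ ∀ j, c j ≠ 0 → A.entry i j = 0 := by
  have h := Finset.sum_eq_zero_iff_of_nonpos
    fun j (_ : j ∈ Finset.univ) => A.entry_mul_nonpos hc hi j
  rw [level, sub_eq_self, h]
  simp only [Finset.mem_univ, true_imp_iff, mul_eq_zero]
  exact forall_congr' fun j => by tauto

/-- The Dynkin diagram of `A` as a simple graph. -/
def graph (A : GCM n) : SimpleGraph (Fin n) where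
  Adj i j := i ≠ j ∧ A.entry i j ≠ 0
  symm := ⟨fun i j h => ⟨h.1.symm, fun h' => h.2 ((A.zero_iff i j).2 h')⟩⟩
  loopless := ⟨fun _ h => h.1 rfl⟩

namespace Realization

variable {A : GCM n} {H : Type*} [AddCommGroup H] [Module ℂ H] {R : A.Realization H}
  {I : Finset (Fin n)} {m : Fin n → ℕ}

theorem det_simpleReflection (i : Fin n) : LinearEquiv.det (R.simpleReflection i) = -1 := by
  have := R.finite
  ext
  have h : (R.simpleReflection i : Dual ℂ H →ₗ[ℂ] Dual ℂ H) =
      LinearMap.transvection (Dual.eval ℂ H (R.coroot i)) (-R.root i) := by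
    ext ν : 1
    simp [simpleReflection_apply, LinearMap.transvection, sub_eq_add_neg]
  rw [LinearEquiv.coe_det, h, LinearMap.transvection.det]
  simp [R.pairing, A.diag]
  norm_num

theorem exists_list_of_mem_parabolicWeyl {I : Set (Fin n)} {w : Dual ℂ H ≃ₗ[ℂ] Dual ℂ H}
    (hw : w ∈ R.parabolicWeyl I) : ∃ l : List (Fin n), (l.map R.simpleReflection).prod = w := by
  induction hw using Subgroup.closure_induction_left with
  | one => exact ⟨[], rfl⟩
  | mul_left x hx y hy ih =>
    obtain ⟨i, -, rfl⟩ := hx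
    obtain ⟨l, rfl⟩ := ih
    exact ⟨i :: l, by simp⟩
  | inv_mul_cancel x hx y hy ih =>
    obtain ⟨i, -, rfl⟩ := hx
    obtain ⟨l, rfl⟩ := ih
    rw [inv_eq_of_mul_eq_one_left (R.simpleReflection_mul_self i)]
    exact ⟨i :: l, by simp⟩

/-- Each simple reflection has determinant -1, so a shortest word computes the sign, and any other
word may be used in its place. -/
theorem det_eq_neg_one_pow_length {I : Set (Fin n)} {w : Dual ℂ H ≃ₗ[ℂ] Dual ℂ H}
    (hw : w ∈ R.parabolicWeyl I) : LinearEquiv.det w = (-1) ^ R.length w := by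
  obtain ⟨l, hl⟩ := exists_list_of_mem_parabolicWeyl hw
  have hne : {k | ∃ l : List (Fin n), l.length = k ∧
      (l.map R.simpleReflection).prod = w}.Nonempty := ⟨l.length, l, rfl, hl⟩
  obtain ⟨l', hl', hw'⟩ := Nat.sInf_mem hne
  rw [length, ← hl', ← hw', map_list_prod, List.map_map]
  have : LinearEquiv.det ∘ R.simpleReflection = fun _ => -1 := funext det_simpleReflection
  rw [this]
  simp

theorem neg_one_pow_length_eq {I : Set (Fin n)} {w : Dual ℂ H ≃ₗ[ℂ] Dual ℂ H}
    (hw : w ∈ R.parabolicWeyl I) {k : ℕ} (hk : LinearEquiv.det w = (-1) ^ k) :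
    (-1 : ℚ) ^ R.length w = (-1) ^ k := by
  rw [det_eq_neg_one_pow_length hw] at hk
  have h1 : (-1 : ℂˣ) ≠ 1 := fun h => by
    have := congrArg Units.val h
    norm_num at this
  rcases Nat.even_or_odd (R.length w) with h | h <;> rcases Nat.even_or_odd k with h' | h' <;>
    simp_all [Odd.neg_one_pow, eq_comm]

namespace Descent

variable {w : Dual ℂ H ≃ₗ[ℂ] Dual ℂ H} {c : Fin n → ℤ}

/-- When coordinate j is first raised, the off-diagonal entries, being nonpositive, have only
increased its level, so the step is at least m j. -/
theorem supported (h : R.Descent I m w c) {j : Fin n} (hj : c j ≠ 0) : j ∈ I ∧ m j ≤ c j := by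
  induction h with
  | one => exact absurd rfl hj
  | @step w c i h hi hpos ih =>
    by_cases hij : j = i
    · subst hij
      refine ⟨hi, ?_⟩
      rw [Pi.add_apply, Pi.single_eq_same]
      by_cases h0 : c j = 0
      · have := A.le_level m h.nonneg h0
        omega
      · have := (ih h0).2
        omega
    · simp only [Pi.add_apply, Pi.single_eq_of_ne hij, add_zero] at hj ⊢
      exact ih hj

/-- A second step at i would exceed m i, so each i is used at most once, at level exactly m i. By
`level_eq_iff` this forces i to be nonadjacent to every index used before. -/
theorem of_minimal (h : R.Descent I m w c) (hc : ∀ j, c j ≠ 0 → c j = m j) :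
    A.graph.IsIndepSet {j | c j ≠ 0} ∧
      LinearEquiv.det w = (-1) ^ (Finset.univ.filter fun j => c j ≠ 0).card := by
  induction h with
  | one => simp [SimpleGraph.IsIndepSet]
  | @step w c i h hi hpos ih =>
    have hnn := h.nonneg i
    have hci := hc i
    simp only [Pi.add_apply, Pi.single_eq_same] at hci
    specialize hci (by dsimp at hnn; omega)
    have h0 : c i = 0 := by
      by_contra h0
      have := (h.supported h0).2
      omega
    have hothers : ∀ j, j ≠ i →
        (c + Pi.single i (A.level m c i) : Fin n → ℤ) j = c j := fun j hj => by
      simp [hj]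
    obtain ⟨ih1, ih2⟩ := ih fun j hj => by
      have hji : j ≠ i := by rintro rfl; exact hj h0
      have := hc j
      rw [hothers j hji] at this
      exact this hj
    have hlev : A.level m c i = m i := by omega
    have hA := (A.level_eq_iff m h.nonneg h0).1 hlev
    have hset : ∀ j, (c + Pi.single i (A.level m c i) : Fin n → ℤ) j ≠ 0 ↔ j = i ∨ c j ≠ 0 := by
      intro j
      by_cases hj : j = i
      · subst hj
        simp [h0, hpos.ne']
      · rw [hothers j hj]; simp [hj]
    simp only [hset]
    constructor
    · rw [SimpleGraph.IsIndepSet, show {j | j = i ∨ c j ≠ 0} = insert i {j | c j ≠ 0} from rfl,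
        Set.pairwise_insert]
      exact ⟨ih1, fun b hb _ => ⟨fun h => h.2 (hA b hb), fun h => h.2 ((A.zero_iff _ _).1 (hA b hb))⟩⟩
    · rw [map_mul, det_simpleReflection, ih2, ← pow_succ']
      congr 1
      rw [← Finset.card_insert_of_notMem (a := i) (by simp [h0])]
      congr 1
      ext j
      simp

theorem exists_of_isIndepSet (hm : ∀ i, 0 < m i) {K : Finset (Fin n)} (hK : K ⊆ I)
    (hi : A.graph.IsIndepSet K) :
    ∃ w, R.Descent I m w fun i => if i ∈ K then (m i : ℤ) else 0 := by
  induction K using Finset.induction_on with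
  | empty => exact ⟨1, by simpa using! Descent.one⟩
  | insert i K hiK ih =>
    rw [Finset.insert_subset_iff] at hK
    rw [Finset.coe_insert, SimpleGraph.IsIndepSet, Set.pairwise_insert] at hi
    obtain ⟨w, hw⟩ := ih hK.2 hi.1
    have hlev : A.level m (fun i => if i ∈ K then (m i : ℤ) else 0) i = m i := by
      rw [level_eq_iff _ _ hw.nonneg (by simp [hiK])]
      intro j hj
      have hjK : j ∈ K := by by_contra h; simp [h] at hj
      have hne : i ≠ j := by rintro rfl; exact hiK hjK
      by_contra hA
      exact (hi.2 j hjK hne).1 ⟨hne, hA⟩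
    refine ⟨R.simpleReflection i * w, ?_⟩
    convert hw.step hK.1 (by rw [hlev]; exact_mod_cast hm i) using 1
    rw [hlev]
    ext j
    by_cases hj : j = i
    · subst hj; simp [hiK]
    · simp [hj]

/-- Λ has trivial stabilizer in W_I: an element fixing it has zero total decrease, hence is a
descent with no steps. -/
theorem eq_of_eq {Λ : Dual ℂ H} (hΛ : ∀ i ∈ I, Λ (R.coroot i) = m i) (hm : ∀ i, 0 < m i)
    {w' : Dual ℂ H ≃ₗ[ℂ] Dual ℂ H} (h : R.Descent I m w c) (h' : R.Descent I m w' c) :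
    w = w' := by
  obtain ⟨d, hd⟩ := exists_of_mem hΛ hm (mul_mem (inv_mem h'.mem_parabolicWeyl)
    h.mem_parabolicWeyl)
  have h1 : (w'⁻¹ * w) Λ = Λ := by
    rw [LinearEquiv.mul_apply, h.apply_eq hΛ, ← h'.apply_eq hΛ, ← LinearEquiv.mul_apply,
      inv_mul_cancel]
    rfl
  have h2 : d = 0 := by
    apply eq_of_sum_smul_root_eq (R := R)
    have := hd.apply_eq hΛ
    rw [h1, eq_comm, sub_eq_self] at this
    simp [this]
  exact (inv_mul_eq_one.1 (hd.eq_one_of_zero h2)).symm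

end Descent

theorem numeratorCoeff_eq_of_unique {ρ : Dual ℂ H} {p : Dual ℂ H × Set (Fin n)} {ν : Dual ℂ H}
    {w : Dual ℂ H ≃ₗ[ℂ] Dual ℂ H}
    (hw : ∀ x, x ∈ R.parabolicWeyl p.2 ∧ x (p.1 + ρ) - (p.1 + ρ) = ν ↔ x = w) :
    R.numeratorCoeff ρ p ν = (-1 : ℚ) ^ R.length w := by
  rw [numeratorCoeff]
  simp only [Set.mem_ofPred_eq, hw]
  simp

theorem exists_of_numeratorCoeff_ne_zero {ρ : Dual ℂ H} {p : Dual ℂ H × Set (Fin n)}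
    {ν : Dual ℂ H} (h : R.numeratorCoeff ρ p ν ≠ 0) :
    ∃ w ∈ R.parabolicWeyl p.2, w (p.1 + ρ) - (p.1 + ρ) = ν := by
  by_contra hne
  push Not at hne
  refine h ?_
  rw [numeratorCoeff]
  exact finsum_mem_eq_zero_of_forall_eq_zero fun w hw => absurd hw.2 (hne w hw.1)

theorem isIndepLike_normalizedNumerator {ρ lam : Dual ℂ H} (hm : ∀ i, 0 < m i)
    (hΛ : ∀ i ∈ I, (lam + ρ) (R.coroot i) = m i) :
    MvPowerSeries.IsIndepLike A.graph I m (R.normalizedNumerator ρ (lam, (I : Set (Fin n)))) := by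
  have hcoeff : ∀ d, MvPowerSeries.coeff d (R.normalizedNumerator ρ (lam, (I : Set (Fin n)))) =
    R.numeratorCoeff ρ (lam, (I : Set (Fin n))) (-∑ i, d i • R.root i) := fun d => rfl
  -- The dictionary: elements contributing to the monomial x^d are exactly the descents with total
  -- decrease d.
  have hw : ∀ (w : Dual ℂ H ≃ₗ[ℂ] Dual ℂ H) (d : Fin n →₀ ℕ),
      (w ∈ R.parabolicWeyl I ∧ w (lam + ρ) - (lam + ρ) = -∑ i, d i • R.root i) ↔
        R.Descent I m w fun i => (d i : ℤ) := by
    intro w d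
    have hsum : ∑ i, d i • R.root i = ∑ i, (((d i : ℕ) : ℤ) : ℂ) • R.root i := by
      simp [Nat.cast_smul_eq_nsmul]
    constructor
    · rintro ⟨h1, h2⟩
      obtain ⟨c, hc⟩ := Descent.exists_of_mem hΛ hm h1
      rw [hc.apply_eq hΛ, hsum, sub_sub_cancel_left, neg_inj] at h2
      rwa [eq_of_sum_smul_root_eq (R := R) h2] at hc
    · intro h
      refine ⟨h.mem_parabolicWeyl, ?_⟩
      rw [h.apply_eq hΛ, hsum, sub_sub_cancel_left]
  refine ⟨hm, ?_, ?_, ?_⟩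
  · intro d hd i hi
    rw [hcoeff] at hd
    obtain ⟨w, h1, h2⟩ := exists_of_numeratorCoeff_ne_zero hd
    have := ((hw w d).1 ⟨h1, h2⟩).supported (j := i) (by exact_mod_cast hi)
    exact ⟨this.1, by exact_mod_cast this.2⟩
  · intro K hK hind
    obtain ⟨w, hD⟩ := Descent.exists_of_isIndepSet (R := R) hm hK hind
    have hr : (fun i => ((MvPowerSeries.restrictExp m K i : ℕ) : ℤ)) =
        fun i => if i ∈ K then (m i : ℤ) else 0 := by
      ext i
      rw [MvPowerSeries.restrictExp_apply]
      split_ifs <;> simp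
    rw [hcoeff, numeratorCoeff_eq_of_unique (w := w)]
    · refine neg_one_pow_length_eq hD.mem_parabolicWeyl ?_
      rw [(hD.of_minimal fun j hj => ?_).2]
      · congr 2
        ext j
        have := (hm j).ne'
        simp [this]
      · by_cases hjK : j ∈ K
        · simp [hjK]
        · simp [hjK] at hj
    · intro x
      rw [hw, hr]
      exact ⟨fun h => h.eq_of_eq hΛ hm hD, by rintro rfl; exact hD⟩
  · intro K hK hdep
    by_contra hne
    rw [hcoeff] at hne
    obtain ⟨w, h1, h2⟩ := exists_of_numeratorCoeff_ne_zero hne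
    have hD := (hw w _).1 ⟨h1, h2⟩
    refine hdep ?_
    have := (hD.of_minimal fun j hj => ?_).1
    · convert this
      ext j
      have := (hm j).ne'
      simp [MvPowerSeries.restrictExp_apply, this]
    · rw [MvPowerSeries.restrictExp_apply] at hj ⊢
      split_ifs at * <;> simp_all

end Realization

end GCM

/-! ### Invariance of L and its extremal monomial. -/

namespace GCM

variable {n : ℕ}

theorem ConnectedSubset.exists_adj {A : GCM n} {I : Finset (Fin n)}
    (h : A.ConnectedSubset (I : Set (Fin n))) {C : Finset (Fin n)} (hC : C ⊆ I)
    (hne : C.Nonempty) (hCI : C ≠ I) : ∃ i ∈ C, ∃ j ∈ I, j ∉ C ∧ A.graph.Adj i j := by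
  obtain ⟨x, hx⟩ := hne
  obtain ⟨y, hy, hyC⟩ := Finset.exists_of_ssubset (hC.ssubset_of_ne hCI)
  obtain ⟨i, hi, j, hj, hij⟩ := h {i | (i : Fin n) ∈ C} ⟨⟨x, hC hx⟩, hx⟩ ⟨⟨y, hy⟩, hyC⟩
  refine ⟨i, hi, j, j.2, hj, fun h' => hj ?_, ?_⟩
  · change (j : Fin n) ∈ C
    rw [← h']
    exact hi
  · rcases hij with hij | hij
    · exact hij
    · exact fun h' => hij ((A.zero_iff _ _).1 h')

namespace Realization

variable {A : GCM n} {H : Type*} [AddCommGroup H] [Module ℂ H] {R : A.Realization H}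

theorem apply_of_mem_parabolicWeyl {I : Set (Fin n)} {δ : Dual ℂ H}
    (hδ : ∀ i ∈ I, δ (R.coroot i) = 0) {w : Dual ℂ H ≃ₗ[ℂ] Dual ℂ H}
    (hw : w ∈ R.parabolicWeyl I) : w δ = δ := by
  have : R.parabolicWeyl I ≤ MulAction.stabilizer (Dual ℂ H ≃ₗ[ℂ] Dual ℂ H) δ := by
    rw [parabolicWeyl, Subgroup.closure_le]
    rintro _ ⟨i, hi, rfl⟩
    rw [SetLike.mem_coe, MulAction.mem_stabilizer_iff, LinearEquiv.smul_def,
      simpleReflection_apply, hδ i hi, zero_smul, sub_zero]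
  exact this hw

/-- `L(lam, I)` depends only on the class of `(lam, I)`. -/
theorem L_eq_of_pairEquiv (ρ : Dual ℂ H) {p q : Dual ℂ H × Set (Fin n)} (h : R.PairEquiv p q) :
    R.L ρ p = R.L ρ q := by
  obtain ⟨lam, I⟩ := p
  obtain ⟨mu, J⟩ := q
  obtain ⟨rfl : I = J, h2⟩ := h
  have key : ∀ w ∈ R.parabolicWeyl I, w (lam + ρ) - (lam + ρ) = w (mu + ρ) - (mu + ρ) := by
    intro w hw
    have h3 : w (lam - mu) = lam - mu :=
      apply_of_mem_parabolicWeyl (R := R) (fun i hi => by simp [h2 i hi]) hw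
    rw [map_sub] at h3
    rw [map_add, map_add]
    rw [sub_eq_sub_iff_add_eq_add] at h3 ⊢
    calc _ = (w lam + mu) + (w ρ + ρ) := by abel
      _ = _ := by rw [h3]; abel
  have : ∀ ν, R.numeratorCoeff ρ (lam, I) ν = R.numeratorCoeff ρ (mu, I) ν := by
    intro ν
    have hset : {w | w ∈ R.parabolicWeyl I ∧ w (lam + ρ) - (lam + ρ) = ν} =
        {w | w ∈ R.parabolicWeyl I ∧ w (mu + ρ) - (mu + ρ) = ν} := by
      ext w
      exact and_congr_right fun hw => by rw [key w hw]
    simp only [numeratorCoeff, hset]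
  have h4 : R.normalizedNumerator ρ (lam, I) = R.normalizedNumerator ρ (mu, I) :=
    funext fun d => this _
  rw [L, L, h4]

/-- The `PairEquiv` relation as an equivalence relation. -/
def pairSetoid (R : A.Realization H) : Setoid (Dual ℂ H × Set (Fin n)) where
  r := R.PairEquiv
  iseqv :=
    { refl := fun _ => ⟨rfl, fun _ _ => rfl⟩
      symm := fun h => ⟨h.1.symm, fun i hi => (h.2 i (h.1 ▸ hi)).symm⟩
      trans := fun h h' => ⟨h.1.trans h'.1, fun i hi => (h.2 i hi).trans (h'.2 i (h.1 ▸ hi))⟩ }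

/-- A pair in `𝒞` is determined up to equivalence by a monomial `∏ x_i ^ m i` that is extremal in
its logarithm, where `m i = (lam + ρ) (α_i^∨)` for `i` in the support. -/
theorem exists_data {ρ : Dual ℂ H} (hρ : ∀ i, ρ (R.coroot i) = 1)
    {p : Dual ℂ H × Set (Fin n)} (hp : p ∈ R.connectedPairs) :
    ∃ (I : Finset (Fin n)) (m : Fin n → ℕ), (I : Set (Fin n)) = p.2 ∧ (∀ i, 0 < m i) ∧
      (∀ i ∈ I, p.1 (R.coroot i) = (m i : ℂ) - 1) ∧
      MvPowerSeries.SupportedAbove I m (R.L ρ p) ∧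
      0 < MvPowerSeries.coeff (MvPowerSeries.restrictExp m I) (R.L ρ p) := by
  obtain ⟨lam, I⟩ := p
  obtain ⟨h1, h2, h3⟩ := hp
  simp only at h2 h3
  obtain ⟨I, rfl⟩ : ∃ J : Finset (Fin n), I = J := ⟨I.toFinite.toFinset, by simp⟩
  have h4 : ∀ i, ∃ k : ℕ, 0 < k ∧ (i ∈ I → lam (R.coroot i) = (k : ℂ) - 1) := by
    intro i
    by_cases hi : i ∈ I
    · obtain ⟨k, hk⟩ := h1 hi
      exact ⟨k + 1, k.succ_pos, fun _ => by rw [hk]; push_cast; ring⟩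
    · exact ⟨1, one_pos, fun h => absurd h hi⟩
  choose m hm hm' using h4
  have hind : MvPowerSeries.IsIndepLike A.graph I m
      (R.normalizedNumerator ρ (lam, (I : Set (Fin n)))) :=
    isIndepLike_normalizedNumerator hm fun i hi => by
      rw [LinearMap.add_apply, hm' i hi, hρ]; ring
  exact ⟨I, m, rfl, hm, fun i hi => hm' i hi, hind.supportedAbove_log,
    hind.coeff_log_pos h3 fun C hC hne hCI => h2.exists_adj hC hne hCI⟩

end Realization

end GCM

/-! ### Triangularity and recovery of the multiset of classes. -/

open scoped Classical in
/-- A triangularity criterion for multisets of power series to be determined by their sum. -/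
theorem multiset_eq_of_sum_map_eq {κ σ : Type*} {F : κ → MvPowerSeries σ ℚ}
    {e : κ → σ →₀ ℕ} {rank : κ → ℕ ×ₗ ℕ}
    (hne : ∀ x, MvPowerSeries.coeff (e x) (F x) ≠ 0)
    (htri : ∀ x y, rank y ≤ rank x → MvPowerSeries.coeff (e y) (F x) ≠ 0 → x = y)
    {M N : Multiset κ} (h : (M.map F).sum = (N.map F).sum) : M = N := by
  by_contra hMN
  set S := (M + N).toFinset.filter fun x => M.count x ≠ N.count x with hS
  have hmem : ∀ x, x ∈ S ↔ M.count x ≠ N.count x := by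
    intro x
    rw [hS, Finset.mem_filter, and_iff_right_iff_imp, Multiset.mem_toFinset, ← Multiset.count_pos,
      Multiset.count_add]
    omega
  have hSne : S.Nonempty := by
    by_contra hS'
    refine hMN (Multiset.ext.2 fun x => ?_)
    by_contra hx
    exact hS' ⟨x, (hmem x).2 hx⟩
  -- At the monomial `e y`, any other x either has equal multiplicities on both sides or, by
  -- triangularity, contributes zero.
  obtain ⟨y, hy, hmin⟩ := S.exists_min_image rank hSne
  have hsum : ∀ K : Multiset κ, K.toFinset ⊆ (M + N).toFinset →
      (K.map F).sum = ∑ x ∈ (M + N).toFinset, K.count x • F x := fun K hK =>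
    (Finset.sum_multiset_map_count K F).trans
      (Finset.sum_subset hK fun x _ hx => by
        rw [Multiset.count_eq_zero_of_notMem (by simpa using hx), zero_smul])
  rw [hsum M (by simp), hsum N (by simp)] at h
  have h1 := congrArg (MvPowerSeries.coeff (e y)) h
  rw [← sub_eq_zero, ← map_sub, ← Finset.sum_sub_distrib, map_sum, Finset.sum_eq_single y] at h1
  · rw [map_sub, map_nsmul, map_nsmul, sub_eq_zero, nsmul_eq_mul, nsmul_eq_mul] at h1
    exact (hmem y).1 hy (by exact_mod_cast mul_right_cancel₀ (hne y) h1)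
  · intro x hx hxy
    by_cases hxS : x ∈ S
    · have : MvPowerSeries.coeff (e y) (F x) = 0 := by
        by_contra h0
        exact hxy (htri x y (hmin x hxS) h0)
      rw [map_sub, map_nsmul, map_nsmul, this, smul_zero, smul_zero, sub_zero]
    · rw [hmem, not_not] at hxS
      rw [hxS, sub_self, map_zero]
  · intro hy'
    exact absurd (Finset.mem_filter.1 hy).1 hy'

/-- Fibres over each point have equal size, and bijections between them glue. -/
theorem exists_equiv_of_map_univ_eq {α β κ : Type*} [Fintype α] [Fintype β] {f : α → κ} {g : β → κ}
    (h : Finset.univ.val.map f = Finset.univ.val.map g) : ∃ e : α ≃ β, ∀ a, g (e a) = f a := by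
  classical
  have hcard : ∀ c, Fintype.card {a // f a = c} = Fintype.card {b // g b = c} := by
    intro c
    have := congrArg (Multiset.count c) h
    rw [Multiset.count_map, Multiset.count_map] at this
    simp only [Fintype.card_subtype, eq_comm (b := c)]
    exact this
  exact ⟨Equiv.ofFiberEquiv fun c => Fintype.equivOfCardEq (hcard c),
    fun a => Equiv.ofFiberEquiv_map _ a⟩

namespace GCM.Realization

variable {n : ℕ} {A : GCM n} {H : Type*} [AddCommGroup H] [Module ℂ H] (R : A.Realization H)

/-- The classes of pairs in `𝒞`. -/
def ConnectedClass : Type _ :=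
  {x : Quotient R.pairSetoid // ∃ p ∈ R.connectedPairs, Quotient.mk _ p = x}

variable {R}

/-- The class of a pair in `𝒞`. -/
def ConnectedClass.mk (p : Dual ℂ H × Set (Fin n)) (hp : p ∈ R.connectedPairs) :
    R.ConnectedClass := ⟨Quotient.mk _ p, p, hp, rfl⟩

theorem ConnectedClass.eq_of_map_sum_eq {ρ : Dual ℂ H} (hρ : ∀ i, ρ (R.coroot i) = 1)
    {M N : Multiset R.ConnectedClass}
    (h : (M.map fun x => Quotient.lift (s := R.pairSetoid) (R.L ρ)
        (fun _ _ h => L_eq_of_pairEquiv ρ h) x.1).sum =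
      (N.map fun x => Quotient.lift (s := R.pairSetoid) (R.L ρ)
        (fun _ _ h => L_eq_of_pairEquiv ρ h) x.1).sum) : M = N := by
  have h1 : ∀ x : R.ConnectedClass, ∃ p ∈ R.connectedPairs, Quotient.mk R.pairSetoid p = x.1 :=
    fun x => x.2
  choose p hp hpx using h1
  choose I m hI hm hval hsupp hpos using fun x => exists_data hρ (hp x)
  have hF : ∀ x : R.ConnectedClass, Quotient.lift (s := R.pairSetoid) (R.L ρ)
      (fun _ _ h => L_eq_of_pairEquiv ρ h) x.1 = R.L ρ (p x) := fun x => by rw [← hpx x]; rfl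
  simp only [hF] at h
  -- Large supports rank first, whence n - |I|: an occurrence forces I y ⊆ I x, and the rank then
  -- gives equality. The sum of m breaks ties in the same way against m x ≤ m y.
  refine multiset_eq_of_sum_map_eq (e := fun x => MvPowerSeries.restrictExp (m x) (I x))
    (rank := fun x => toLex (n - (I x).card, ∑ i ∈ I x, m x i)) (fun x => (hpos x).ne') ?_ h
  intro x y hrank hxy
  have hle : ∀ i ∈ I y, i ∈ I x ∧ m x i ≤ m y i := by
    intro i hi
    have := hsupp x _ hxy i
    rw [MvPowerSeries.restrictExp_apply, if_pos hi] at this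
    exact this (hm y i).ne'
  have hcard := fun x => (Finset.card_le_univ (I x)).trans_eq (Fintype.card_fin n)
  have hcx := hcard x
  have hcy := hcard y
  have hsub : I y ⊆ I x := fun i hi => (hle i hi).1
  have hII : I y = I x := by
    refine Finset.eq_of_subset_of_card_le hsub ?_
    rcases Prod.Lex.toLex_le_toLex.1 hrank with h | h
    · dsimp only at h; omega
    · have := h.1; dsimp only at this; omega
  have hsum : ∑ i ∈ I y, m y i ≤ ∑ i ∈ I y, m x i := by
    rcases Prod.Lex.toLex_le_toLex.1 hrank with h | h
    · dsimp only at h; rw [hII] at h; omega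
    · have := h.2; dsimp only at this; rwa [← hII] at this
  have hmm : ∀ i ∈ I y, m x i = m y i :=
    (Finset.sum_eq_sum_iff_of_le fun i hi => (hle i hi).2).1
      (le_antisymm (Finset.sum_le_sum fun i hi => (hle i hi).2) hsum)
  apply Subtype.ext
  rw [← hpx x, ← hpx y]
  refine Quotient.sound (s := R.pairSetoid) ⟨by rw [← hI x, ← hI y, hII], fun i hi => ?_⟩
  rw [← hI x, Finset.mem_coe] at hi
  rw [hval x i hi, hval y i (hII ▸ hi), hmm i (hII ▸ hi)]

end GCM.Realization

theorem mainTheorem3 {n : ℕ} (A : GCM n) (hA : A.Symmetrizable)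
    {H : Type*} [AddCommGroup H] [Module ℂ H] (R : A.Realization H)
    (ρ : Module.Dual ℂ H) (hρ : ∀ i, ρ (R.coroot i) = 1)
    (r s : ℕ)
    (p : Fin r → Module.Dual ℂ H × Set (Fin n)) (hp : ∀ k, p k ∈ R.connectedPairs)
    (q : Fin s → Module.Dual ℂ H × Set (Fin n)) (hq : ∀ k, q k ∈ R.connectedPairs) :
    ∑ k, R.L ρ (p k) = ∑ k, R.L ρ (q k) ↔
      ∃ h : r = s, ∃ σ : Equiv.Perm (Fin r),
        ∀ k, R.PairEquiv (p k) (q (Fin.cast h (σ k))) := by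
  constructor
  · intro h
    have key : Finset.univ.val.map (fun k => GCM.Realization.ConnectedClass.mk (p k) (hp k)) =
        Finset.univ.val.map (fun k => GCM.Realization.ConnectedClass.mk (q k) (hq k)) := by
      refine GCM.Realization.ConnectedClass.eq_of_map_sum_eq hρ ?_
      rw [Multiset.map_map, Multiset.map_map]
      exact h
    obtain ⟨e, he⟩ := exists_equiv_of_map_univ_eq key
    obtain rfl : r = s := by simpa using Fintype.card_congr e
    exact ⟨rfl, e, fun k => Quotient.exact (s := R.pairSetoid) (congrArg Subtype.val (he k)).symm⟩
  · rintro ⟨rfl, σ, hσ⟩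
    rw [← Equiv.sum_comp σ fun k => R.L ρ (q k)]
    exact Finset.sum_congr rfl fun k _ => GCM.Realization.L_eq_of_pairEquiv ρ (hσ k)
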